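/- \textbf{Setting.} Let $M$ be a complex manifold of dimension $n$ and let $(E,[\cdot,\cdot]_E,\rho)$ be a holomorphic Lie algebroid of rank $m$ over $M$: a holomorphic vector bundle $\pi:E\to M$ with a holomorphic bundle morphism $\rho:E\to T'M$ (the anchor) and a Lie bracket on (local) holomorphic sections with $[s_1,gs_2]_E=g[s_1,s_2]_E+\rho(s_1)(g)\,s_2$ for holomorphic functions $g$. Let $F:E\to\mathbb R_+$ be a Finsler function: smooth outside the zero section, homogeneous of some degree $r>0$ ($F(\lambda u)=|\lambda|^rF(u)$, $\lambda\in\mathbb C$), and strictly pseudoconvex, i.e. in all coordinates $(z^k,u^\alpha)$ on $E$ given by a holomorphic chart $(z^k)$ of $M$ and a holomorphic frame $(e_\alpha)$ of $E$ over its domain, the matrix $h_{\alpha\bar\beta}=\dot\partial_\alpha\dot\partial_{\bar\beta}F$ is positive definite outside the zero section, where $\dot\partial_\alpha=\partial/\partial u^\alpha$, $\partial_k=\partial/\partial z^k$, and barred indices denote conjugate coordinates. Repeated indices are summed. Fix such coordinates. Let $(h^{\bar\gamma\alpha})$ be the inverse matrix ($h^{\bar\gamma\alpha}h_{\alpha\bar\beta}=\delta^{\bar\gamma}_{\bar\beta}$),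 $h=\det(h_{\alpha\bar\beta})$, $\rho(e_\alpha)=\rho^k_\alpha\partial_k$, $[e_\alpha,e_\beta]_E=\mathcal C^\gamma_{\alpha\beta}e_\gamma$, $\mathcal C_\alpha=\mathcal C^\beta_{\alpha\beta}$, and $$N^\beta_\alpha=h^{\bar\sigma\beta}\rho^k_\alpha\partial_k\dot\partial_{\bar\sigma}F,\quad \delta_\alpha=\rho^k_\alpha\partial_k-N^\beta_\alpha\dot\partial_\beta,\quad \delta_{\bar\alpha}=\overline{\rho^k_\alpha}\,\partial_{\bar k}-\overline{N^\beta_\alpha}\,\dot\partial_{\bar\beta},\quad C^\gamma_{\alpha\beta}=h^{\bar\sigma\gamma}\dot\partial_\beta h_{\alpha\bar\sigma},\quad C_\alpha=C^\beta_{\alpha\beta}.$$ Let $\mathcal T_{\mathbb C}E=\{(e,v)\in E_{\mathbb C}\times T_{\mathbb C}E:\rho_{\mathbb C}(e)=\pi_*(v)\}=\mathcal T'E\oplus\mathcal T''E$ be the complexified prolongation, a complex vector bundle of rank $4m$ over the manifold $E$, with anchor $(e,v)\mapsto v$ and its Lie algebroid bracket (bracket of complex vector fields in the second component; in the first component $[\xi,\eta]^\gamma=\xi(\eta^\gamma)-\eta(\xi^\gamma)+\mathcal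 C^\gamma_{\alpha\beta}\xi^\alpha\eta^\beta$ and the conjugate formula). Its adapted frame consists of $\mathcal X_\alpha=(e_\alpha,\delta_\alpha)$, $\mathcal V_\alpha=(0,\dot\partial_\alpha)$ and their conjugates, with dual coframe $\mathcal Z^\alpha,\delta\mathcal V^\alpha,\mathcal Z^{\bar\alpha},\delta\mathcal V^{\bar\alpha}$. Let $$\mathcal G=h_{\alpha\bar\beta}\mathcal Z^\alpha\otimes\mathcal Z^{\bar\beta}+h_{\alpha\bar\beta}\delta\mathcal V^\alpha\otimes\delta\mathcal V^{\bar\beta},\qquad d\mathcal V=i^{2m^2}h^2\,\mathcal Z\wedge\bar{\mathcal Z}\wedge\delta\mathcal V\wedge\overline{\delta\mathcal V},$$ where $\mathcal Z=\mathcal Z^1\wedge\dots\wedge\mathcal Z^m$, $\delta\mathcal V=\delta\mathcal V^1\wedge\dots\wedge\delta\mathcal V^m$. The divergence of a section $Z$ of $\mathcal T_{\mathbb C}E$ is defined by $\mathcal L_Z\,d\mathcal V=(\operatorname{div}Z)\,d\mathcal V$, where $(\mathcal L_Z\,d\mathcal V)(\xi_1,\dots,\xi_{4m})=Z\big(d\mathcal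 V(\xi_1,\dots,\xi_{4m})\big)-\sum_i d\mathcal V(\xi_1,\dots,[Z,\xi_i],\dots,\xi_{4m})$; put $\operatorname{div}^hZ=\operatorname{div}(\mathcal Z^\alpha(Z)\mathcal X_\alpha)$ and $\operatorname{div}^vZ=\operatorname{div}(\delta\mathcal V^\alpha(Z)\mathcal V_\alpha)$. The gradient of a function $f$ is the section $\operatorname{grad}f$ of $\mathcal T'E$ with $\mathcal G(\operatorname{grad}f,W)=Wf$ for all $W\in\mathcal T''E$; $\operatorname{grad}^hf$ and $\operatorname{grad}^vf$ are its components along the $\mathcal X_\alpha$ and along the $\mathcal V_\alpha$. Put $\Delta^h=\operatorname{div}^h\circ\operatorname{grad}^h$ and $\Delta^v=\operatorname{div}^v\circ\operatorname{grad}^v$. \textbf{Proposition.} Let $f$ be a complex-valued function on $E$ which is $C^\infty$ outside the zero section (for example $f\in C^\infty(E)$). At every point of the coordinate domain outside the zero section, $\operatorname{grad}f$ exists and is unique, with $$\operatorname{grad}^hf=h^{\bar\gamma\alpha}(\delta_{\bar\gamma}f)\,\mathcal X_\alpha,\qquad \operatorname{grad}^vf=h^{\bar\gamma\alpha}(\dot\partial_{\bar\gamma}f)\,\mathcal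 V_\alpha;$$ the divergences of $\operatorname{grad}^hf$ and $\operatorname{grad}^vf$ exist and are unique; and $$\Delta^hf=\frac1h\,\delta_\alpha\big[h\,h^{\bar\gamma\alpha}(\delta_{\bar\gamma}f)\big]-h^{\bar\gamma\alpha}(\delta_{\bar\gamma}f)\,\mathcal C_\alpha,$$ $$\Delta^vf=\frac1h\,\dot\partial_\alpha\big[h\,h^{\bar\gamma\alpha}(\dot\partial_{\bar\gamma}f)\big]+h^{\bar\gamma\alpha}(\dot\partial_{\bar\gamma}f)\,C_\alpha.$$ -/

import Mathlib

open Bundle Set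
open scoped Manifold ContDiff

noncomputable section

namespace FinslerAlgebroid

/-! ### Holomorphic Lie algebroids -/

section Global

variable (n m : ℕ) {M : Type*} [TopologicalSpace M] [ChartedSpace (Fin n → ℂ) M]
  [IsManifold 𝓘(ℂ, Fin n → ℂ) ω M]
  (E : M → Type*) [TopologicalSpace (TotalSpace (Fin m → ℂ) E)]
  [∀ x, AddCommGroup (E x)] [∀ x, Module ℂ (E x)] [∀ x, TopologicalSpace (E x)]
  [FiberBundle (Fin m → ℂ) E]

/-- The derivative `v(g)` of a function `g : M → ℂ` along a tangent vector `v ∈ T'_x M`. -/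
def dirDeriv {x : M} (v : TangentSpace 𝓘(ℂ, Fin n → ℂ) x) (g : M → ℂ) : ℂ :=
  mfderiv 𝓘(ℂ, Fin n → ℂ) 𝓘(ℂ, ℂ) g x v

/-- `s` is a holomorphic section of `E` over `U`. -/
def IsHolSection (s : ∀ x, E x) (U : Set M) : Prop :=
  ContMDiffOn 𝓘(ℂ, Fin n → ℂ) (𝓘(ℂ, Fin n → ℂ).prod 𝓘(ℂ, Fin m → ℂ)) ω
    (fun x => (⟨x, s x⟩ : TotalSpace (Fin m → ℂ) E)) U

/-- A holomorphic Lie algebroid structure on the holomorphic vector bundle `E` of rank `m` over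
the complex `n`-manifold `M`: a holomorphic anchor `ρ : E → T'M`, and a Lie bracket on (the sheaf
of) holomorphic sections which satisfies the Leibniz rule. The holomorphic tangent bundle `T'M` is
the tangent bundle of `M` as a complex manifold. The value of the bracket matters only on open sets
on which both arguments are holomorphic, where it depends only on the restrictions of the
arguments (`bracket_congr`). -/
structure HolLieAlgebroid where
  anchor : ∀ x : M, E x →ₗ[ℂ] TangentSpace 𝓘(ℂ, Fin n → ℂ) x
  anchor_hol : ∀ (U : Set M) (s : ∀ x, E x), IsOpen U → IsHolSection n m E s U →
    ContMDiffOn 𝓘(ℂ, Fin n → ℂ) 𝓘(ℂ, Fin n → ℂ).tangent ω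
      (fun x => (⟨x, anchor x (s x)⟩ : TangentBundle 𝓘(ℂ, Fin n → ℂ) M)) U
  bracket : (∀ x, E x) → (∀ x, E x) → ∀ x, E x
  bracket_congr : ∀ (U : Set M) (s s' t t' : ∀ x, E x), IsOpen U →
    IsHolSection n m E s U → IsHolSection n m E t U →
    (∀ x ∈ U, s x = s' x) → (∀ x ∈ U, t x = t' x) →
    ∀ x ∈ U, bracket s t x = bracket s' t' x
  bracket_hol : ∀ (U : Set M) (s t : ∀ x, E x), IsOpen U →
    IsHolSection n m E s U → IsHolSection n m E t U → IsHolSection n m E (bracket s t) U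
  bracket_add : ∀ (U : Set M) (s t t' : ∀ x, E x), IsOpen U → IsHolSection n m E s U →
    IsHolSection n m E t U → IsHolSection n m E t' U →
    ∀ x ∈ U, bracket s (fun y => t y + t' y) x = bracket s t x + bracket s t' x
  bracket_skew : ∀ (U : Set M) (s t : ∀ x, E x), IsOpen U → IsHolSection n m E s U →
    IsHolSection n m E t U → ∀ x ∈ U, bracket s t x = - bracket t s x
  bracket_jacobi : ∀ (U : Set M) (s t r : ∀ x, E x), IsOpen U → IsHolSection n m E s U →
    IsHolSection n m E t U → IsHolSection n m E r U →
    ∀ x ∈ U, bracket s (bracket t r) x + bracket t (bracket r s) x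
      + bracket r (bracket s t) x = 0
  bracket_leibniz : ∀ (U : Set M) (s t : ∀ x, E x) (g : M → ℂ), IsOpen U →
    IsHolSection n m E s U → IsHolSection n m E t U →
    ContMDiffOn 𝓘(ℂ, Fin n → ℂ) 𝓘(ℂ, ℂ) ω g U →
    ∀ x ∈ U, bracket s (fun y => g y • t y) x
      = g x • bracket s t x
        + dirDeriv n (anchor x (s x)) g • t x

/-- Local holomorphic coordinates `(z^k, u^α)` on `E`: a holomorphic chart `z` of `M` together with
a holomorphic frame `e_α` of `E` over the domain of the chart. -/
structure HolCoords where
  chart : OpenPartialHomeomorph M (Fin n → ℂ)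
  chart_mem : chart ∈ IsManifold.maximalAtlas 𝓘(ℂ, Fin n → ℂ) ω M
  frame : Fin m → ∀ x, E x
  isFrame : IsLocalFrameOn 𝓘(ℂ, Fin n → ℂ) (Fin m → ℂ) ω frame chart.source

end Global

/-! ### Wirtinger derivatives in the coordinates `(z, u)` -/

/-- The space `ℂⁿ × ℂᵐ` of coordinates `(z, u)`. -/
abbrev Coord (n m : ℕ) : Type := (Fin n → ℂ) × (Fin m → ℂ)

section Wirtinger

variable {n m : ℕ}

/-- `½ (D_v g - i D_{iv} g)` at `p`. -/
def wirt (v : Coord n m) (g : Coord n m → ℂ) (p : Coord n m) : ℂ :=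
  (1 / 2) * (fderiv ℝ g p v - Complex.I * fderiv ℝ g p (Complex.I • v))

/-- `½ (D_v g + i D_{iv} g)` at `p`. -/
def wirtBar (v : Coord n m) (g : Coord n m → ℂ) (p : Coord n m) : ℂ :=
  (1 / 2) * (fderiv ℝ g p v + Complex.I * fderiv ℝ g p (Complex.I • v))

/-- `∂_k = ∂/∂z^k`. -/
def dz (k : Fin n) : (Coord n m → ℂ) → Coord n m → ℂ := wirt (Pi.single k 1, 0)

/-- `∂_k̄ = ∂/∂z̄^k`. -/
def dzBar (k : Fin n) : (Coord n m → ℂ) → Coord n m → ℂ := wirtBar (Pi.single k 1, 0)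

/-- `∂̇_α = ∂/∂u^α`. -/
def du (α : Fin m) : (Coord n m → ℂ) → Coord n m → ℂ := wirt (0, Pi.single α 1)

/-- `∂̇_ᾱ = ∂/∂ū^α`. -/
def duBar (α : Fin m) : (Coord n m → ℂ) → Coord n m → ℂ := wirtBar (0, Pi.single α 1)

end Wirtinger

section TangentAction

variable {n m : ℕ}

/-- The fibre of `T_ℂE = T'E ⊕ T''E` in coordinates: the first factor holds the components along
`∂_k, ∂̇_α`, the second one the components along `∂_k̄, ∂̇_ᾱ`. -/
abbrev TC (n m : ℕ) : Type := Coord n m × Coord n m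

/-- The fibre of `E_ℂ = E' ⊕ E''`: components along `e_α` and along `e_ᾱ`. -/
abbrev EC (m : ℕ) : Type := (Fin m → ℂ) × (Fin m → ℂ)

/-- The derivative at `p` of a function along a complex tangent vector `v ∈ T_ℂE`. -/
def act (v : TC n m) (g : Coord n m → ℂ) (p : Coord n m) : ℂ :=
  (∑ k, v.1.1 k * dz k g p) + (∑ α, v.1.2 α * du α g p)
    + (∑ k, v.2.1 k * dzBar k g p) + ∑ α, v.2.2 α * duBar α g p

/-- The Lie bracket of complex vector fields on `E`, in coordinates. -/
def fieldBracket (X Y : Coord n m → TC n m) (p : Coord n m) : TC n m :=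
  ((fun k => act (X p) (fun q => (Y q).1.1 k) p - act (Y p) (fun q => (X q).1.1 k) p,
    fun α => act (X p) (fun q => (Y q).1.2 α) p - act (Y p) (fun q => (X q).1.2 α) p),
   (fun k => act (X p) (fun q => (Y q).2.1 k) p - act (Y p) (fun q => (X q).2.1 k) p,
    fun α => act (X p) (fun q => (Y q).2.2 α) p - act (Y p) (fun q => (X q).2.2 α) p))

end TangentAction

/-! ### The prolongation, the Chern-Finsler connection and the Laplacians -/

section Local

variable {n m : ℕ} {M : Type*} [TopologicalSpace M] [ChartedSpace (Fin n → ℂ) M]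
  [IsManifold 𝓘(ℂ, Fin n → ℂ) ω M]
  {E : M → Type*} [TopologicalSpace (TotalSpace (Fin m → ℂ) E)]
  [∀ x, AddCommGroup (E x)] [∀ x, Module ℂ (E x)] [∀ x, TopologicalSpace (E x)]
  [FiberBundle (Fin m → ℂ) E]

/-- The point of `E` with coordinates `(z, u)`, i.e. `u^α e_α(z)`. -/
def HolCoords.point (κ : HolCoords n m E) (p : Coord n m) : TotalSpace (Fin m → ℂ) E :=
  ⟨κ.chart.symm p.1, ∑ α, p.2 α • κ.frame α (κ.chart.symm p.1)⟩

/-- The coordinates of the points of `E`, outside the zero section, over the domain of the chart. -/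
def HolCoords.slit (κ : HolCoords n m E) : Set (Coord n m) :=
  {p | p.1 ∈ κ.chart.target ∧ p.2 ≠ 0}

/-- A function on `E` in the coordinates `(z, u)`. -/
def HolCoords.pull (κ : HolCoords n m E) (f : TotalSpace (Fin m → ℂ) E → ℂ) : Coord n m → ℂ :=
  fun p => f (κ.point p)

variable (A : HolLieAlgebroid n m E) (κ : HolCoords n m E) (F : TotalSpace (Fin m → ℂ) E → ℝ)
  (f : TotalSpace (Fin m → ℂ) E → ℂ)

/-- The anchor coefficients `ρ^k_α(z)`: `ρ(e_α) = ρ^k_α ∂/∂z^k`. -/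
def rho (α : Fin m) (k : Fin n) (z : Fin n → ℂ) : ℂ :=
  (mfderiv 𝓘(ℂ, Fin n → ℂ) 𝓘(ℂ, Fin n → ℂ) κ.chart (κ.chart.symm z)
    (A.anchor (κ.chart.symm z) (κ.frame α (κ.chart.symm z))) : Fin n → ℂ) k

/-- The structure functions `𝒞^γ_{αβ}(z)`: `[e_α, e_β] = 𝒞^γ_{αβ} e_γ`. -/
def strC (γ α β : Fin m) (z : Fin n → ℂ) : ℂ :=
  κ.isFrame.coeff γ (κ.chart.symm z)
    (A.bracket (κ.frame α) (κ.frame β) (κ.chart.symm z))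

/-- `𝒞_α = 𝒞^β_{αβ}`. -/
def trC (α : Fin m) (p : Coord n m) : ℂ := ∑ β, strC A κ β α β p.1

/-- The matrix `h_{αβ̄} = ∂̇_α ∂̇_β̄ F` of the complex Finsler metric tensor (row `α`, column `β̄`). -/
def hMat (p : Coord n m) : Matrix (Fin m) (Fin m) ℂ :=
  Matrix.of fun α β => du α (duBar β (κ.pull fun w => (F w : ℂ))) p

/-- `h^{γ̄α}`, with `h^{γ̄α} h_{αβ̄} = δ^γ̄_β̄` (row `γ̄`, column `α`). -/
def hInv (γ α : Fin m) (p : Coord n m) : ℂ := (hMat κ F p)⁻¹ γ α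

/-- `h = det (h_{αβ̄})`. -/
def hDet (p : Coord n m) : ℂ := (hMat κ F p).det

/-- `∂_α = ρ^k_α ∂_k`. -/
def dRho (α : Fin m) (g : Coord n m → ℂ) (p : Coord n m) : ℂ :=
  ∑ k, rho A κ α k p.1 * dz k g p

/-- The coefficients `N_α^β = h^{σ̄β} ∂_α ∂̇_σ̄ F` of the Chern-Finsler nonlinear connection. -/
def connN (α β : Fin m) (p : Coord n m) : ℂ :=
  ∑ σ, hInv κ F σ β p * dRho A κ α (duBar σ (κ.pull fun w => (F w : ℂ))) p

/-- `δ_α = ρ^k_α ∂_k - N_α^β ∂̇_β`. -/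
def delta (α : Fin m) (g : Coord n m → ℂ) (p : Coord n m) : ℂ :=
  dRho A κ α g p - ∑ β, connN A κ F α β p * du β g p

/-- `δ_ᾱ = ρ^k̄_ᾱ ∂_k̄ - N_ᾱ^β̄ ∂̇_β̄`, where `ρ^k̄_ᾱ, N_ᾱ^β̄` are the conjugates of
`ρ^k_α, N_α^β`. -/
def deltaBar (α : Fin m) (g : Coord n m → ℂ) (p : Coord n m) : ℂ :=
  ∑ k, star (rho A κ α k p.1) * dzBar k g p
    - ∑ β, star (connN A κ F α β p) * duBar β g p

/-- The coefficients `C^γ_{αβ} = h^{σ̄γ} ∂̇_β (h_{ασ̄})` of the Chern-Finsler linear connection. -/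
def connC (γ α β : Fin m) (p : Coord n m) : ℂ :=
  ∑ σ, hInv κ F σ γ p * du β (fun q => hMat κ F q α σ) p

/-- `C_α = C^β_{αβ}`. -/
def trConnC (α : Fin m) (p : Coord n m) : ℂ := ∑ β, connC κ F β α β p

/-- The fibre at `p` of the complexified prolongation
`𝒯_ℂE = {(e, v) ∈ E_ℂ × T_ℂE | ρ_ℂ(e) = π_*(v)}`. -/
def prolongation (p : Coord n m) : Submodule ℂ (EC m × TC n m) where
  carrier := {ξ | (∀ k, ∑ α, rho A κ α k p.1 * ξ.1.1 α = ξ.2.1.1 k) ∧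
    (∀ k, ∑ α, star (rho A κ α k p.1) * ξ.1.2 α = ξ.2.2.1 k)}
  zero_mem' := by simp
  add_mem' := by
    rintro a b ⟨h1, h2⟩ ⟨h3, h4⟩
    refine ⟨fun k => ?_, fun k => ?_⟩
    · simp [mul_add, Finset.sum_add_distrib, h1 k, h3 k]
    · simpa [mul_add, Finset.sum_add_distrib] using congrArg₂ (· + ·) (h2 k) (h4 k)
  smul_mem' := by
    rintro c a ⟨h1, h2⟩
    refine ⟨fun k => ?_, fun k => ?_⟩
    · simp [← h1 k, Finset.mul_sum, mul_left_comm]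
    · simpa [Finset.mul_sum, mul_left_comm] using congrArg (c * ·) (h2 k)

/-- The fibre of `𝒯'E` inside `𝒯_ℂE`. -/
def prolongationHol (p : Coord n m) : Set (EC m × TC n m) :=
  {ξ | ξ ∈ prolongation A κ p ∧ ξ.1.2 = 0 ∧ ξ.2.2 = 0}

/-- The fibre of `𝒯''E` inside `𝒯_ℂE`. -/
def prolongationAnti (p : Coord n m) : Set (EC m × TC n m) :=
  {ξ | ξ ∈ prolongation A κ p ∧ ξ.1.1 = 0 ∧ ξ.2.1 = 0}

/-- Smooth sections of `𝒯_ℂE` over the coordinate domain, outside the zero section. -/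
def IsSmoothSection (ξ : Coord n m → EC m × TC n m) : Prop :=
  ContDiffOn ℝ ∞ ξ κ.slit ∧ ∀ p ∈ κ.slit, ξ p ∈ prolongation A κ p

/-- The bracket of sections of the prolongation. Its component in `T_ℂE` is the bracket of vector
fields, its component in `E_ℂ` is
`[ξ, η]^γ = ρ_𝒯(ξ)(η^γ) - ρ_𝒯(η)(ξ^γ) + 𝒞^γ_{αβ} ξ^α η^β`, and the conjugate formula along `e_γ̄`. -/
def bracket (ξ η : Coord n m → EC m × TC n m) (p : Coord n m) : EC m × TC n m :=
  ((fun γ => act (ξ p).2 (fun q => (η q).1.1 γ) p - act (η p).2 (fun q => (ξ q).1.1 γ) p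
      + ∑ α, ∑ β, strC A κ γ α β p.1 * (ξ p).1.1 α * (η p).1.1 β,
    fun γ => act (ξ p).2 (fun q => (η q).1.2 γ) p - act (η p).2 (fun q => (ξ q).1.2 γ) p
      + ∑ α, ∑ β, star (strC A κ γ α β p.1) * (ξ p).1.2 α * (η p).1.2 β),
   fieldBracket (fun q => (ξ q).2) (fun q => (η q).2) p)

/-- The horizontal vector `𝒳_α = 𝒵_α - N_α^β 𝒱_β` of the adapted frame, where
`𝒵_α = (e_α, ρ^k_α ∂_k)` and `𝒱_α = (0, ∂̇_α)`. -/
def frameX (α : Fin m) (p : Coord n m) : EC m × TC n m :=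
  ((Pi.single α 1, 0), ((fun k => rho A κ α k p.1, fun β => - connN A κ F α β p), 0))

/-- The vertical vector `𝒱_α = (0, ∂̇_α)` of the adapted frame. -/
def frameV (α : Fin m) : EC m × TC n m := ((0, 0), ((0, Pi.single α 1), 0))

/-- `𝒵^α`. -/
def coZ (α : Fin m) (ξ : EC m × TC n m) : ℂ := ξ.1.1 α

/-- `𝒵^ᾱ`. -/
def coZBar (α : Fin m) (ξ : EC m × TC n m) : ℂ := ξ.1.2 α

/-- `δ𝒱^α = 𝒱^α + N^α_β 𝒵^β`. -/
def coV (p : Coord n m) (α : Fin m) (ξ : EC m × TC n m) : ℂ :=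
  ξ.2.1.2 α + ∑ β, connN A κ F β α p * ξ.1.1 β

/-- `δ𝒱^ᾱ`, the conjugate of `δ𝒱^α`. -/
def coVBar (p : Coord n m) (α : Fin m) (ξ : EC m × TC n m) : ℂ :=
  ξ.2.2.2 α + ∑ β, star (connN A κ F β α p) * ξ.1.2 β

/-- The index set of the adapted frame, in the order `𝒳, 𝒳̄, 𝒱, 𝒱̄`. -/
abbrev Idx (m : ℕ) : Type := (Fin m ⊕ Fin m) ⊕ (Fin m ⊕ Fin m)

/-- All the covectors `𝒵^α, 𝒵^ᾱ, δ𝒱^α, δ𝒱^ᾱ` at `p`, as one linear map. -/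
def coframe (p : Coord n m) : (EC m × TC n m) →ₗ[ℂ] (Idx m → ℂ) where
  toFun ξ := Sum.elim (Sum.elim (fun α => coZ α ξ) (fun α => coZBar α ξ))
    (Sum.elim (fun α => coV A κ F p α ξ) (fun α => coVBar A κ F p α ξ))
  map_add' a b := by
    ext ((i | i) | (i | i)) <;>
      simp [coZ, coZBar, coV, coVBar, mul_add, Finset.sum_add_distrib] <;> ring
  map_smul' c a := by
    ext ((i | i) | (i | i)) <;>
      simp [coZ, coZBar, coV, coVBar, mul_add, Finset.mul_sum, mul_left_comm]

/-- The volume form `d𝒱 = i^{2m²} h² 𝒵 ∧ 𝒵̄ ∧ δ𝒱 ∧ δ𝒱̄` of the prolongation: the wedge product of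
the `4m` covectors of the coframe is the determinant of the matrix of their values. -/
def volForm (p : Coord n m) : (EC m × TC n m) [⋀^Idx m]→ₗ[ℂ] ℂ :=
  (Complex.I ^ (2 * m ^ 2) * hDet κ F p ^ 2) •
    (Matrix.detRowAlternating (n := Idx m) (R := ℂ)).compLinearMap (coframe A κ F p)

/-- `(ℒ_Z d𝒱)(ξ) = Z(d𝒱(ξ)) - ∑_i d𝒱(…, [Z, ξ_i], …)`. -/
def lieDerivVol (Z : Coord n m → EC m × TC n m) (ξ : Idx m → Coord n m → EC m × TC n m)
    (p : Coord n m) : ℂ :=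
  act (Z p).2 (fun q => volForm A κ F q fun i => ξ i q) p
    - ∑ i, volForm A κ F p (Function.update (fun j => ξ j p) i (bracket A κ Z (ξ i) p))

/-- `d` is the divergence of `Z` at `p`: `ℒ_Z d𝒱 = d · d𝒱` at `p`. -/
def IsDivAt (Z : Coord n m → EC m × TC n m) (p : Coord n m) (d : ℂ) : Prop :=
  ∀ ξ : Idx m → Coord n m → EC m × TC n m, (∀ i, IsSmoothSection A κ (ξ i)) →
    lieDerivVol A κ F Z ξ p = d * volForm A κ F p fun i => ξ i p

open scoped Classical in
/-- The divergence of a section of the prolongation. -/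
def divergence (Z : Coord n m → EC m × TC n m) (p : Coord n m) : ℂ :=
  if h : ∃ d, IsDivAt A κ F Z p d then h.choose else 0

/-- The component `Z^h = Z^α 𝒳_α` of a section `Z` along `H𝒯'E`. -/
def horPart (Z : Coord n m → EC m × TC n m) (p : Coord n m) : EC m × TC n m :=
  ∑ α, coZ α (Z p) • frameX A κ F α p

/-- The component `Z^v = V^α 𝒱_α` of a section `Z` along `V𝒯'E`. -/
def verPart (Z : Coord n m → EC m × TC n m) (p : Coord n m) : EC m × TC n m :=
  ∑ α, coV A κ F p α (Z p) • frameV α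

/-- `div^h Z = div Z^h`. -/
def divH (Z : Coord n m → EC m × TC n m) : Coord n m → ℂ := divergence A κ F (horPart A κ F Z)

/-- `div^v Z = div Z^v`. -/
def divV (Z : Coord n m → EC m × TC n m) : Coord n m → ℂ := divergence A κ F (verPart A κ F Z)

/-- The metric structure `𝒢 = h_{αβ̄} 𝒵^α ⊗ 𝒵̄^β + h_{αβ̄} δ𝒱^α ⊗ δ𝒱̄^β`. -/
def metricG (p : Coord n m) (ξ η : EC m × TC n m) : ℂ :=
  (∑ α, ∑ β, hMat κ F p α β * coZ α ξ * coZBar β η)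
    + ∑ α, ∑ β, hMat κ F p α β * coV A κ F p α ξ * coVBar A κ F p β η

/-- `g ∈ 𝒯'E` is the gradient of `f` at `p`: `𝒢(g, W) = W f` for all `W = Z̄ ∈ 𝒯''E`. For
real-valued `f` this is the complex conjugate of the equation `𝒢(Z, g̅) = Z f`, `Z ∈ 𝒯'E`. -/
def IsGradAt (p : Coord n m) (g : EC m × TC n m) : Prop :=
  g ∈ prolongationHol A κ p ∧
    ∀ W ∈ prolongationAnti A κ p, metricG A κ F p g W = act W.2 (κ.pull f) p

open scoped Classical in
/-- The gradient of `f`, a section of `𝒯'E`. -/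
def grad (p : Coord n m) : EC m × TC n m :=
  if h : ∃ g, IsGradAt A κ F f p g then h.choose else 0

/-- `grad^h f`. -/
def gradH : Coord n m → EC m × TC n m := horPart A κ F (grad A κ F f)

/-- `grad^v f`. -/
def gradV : Coord n m → EC m × TC n m := verPart A κ F (grad A κ F f)

/-- The horizontal Laplacian `Δ^h f = div^h (grad^h f)`, in the coordinates `(z, u)`. -/
def lapH : Coord n m → ℂ := divH A κ F (gradH A κ F f)

/-- The vertical Laplacian `Δ^v f = div^v (grad^v f)`, in the coordinates `(z, u)`. -/
def lapV : Coord n m → ℂ := divV A κ F (gradV A κ F f)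

/-- Smoothness, in the real sense, of a function on `E` outside the zero section. -/
def SmoothOffZero {V : Type*} [NormedAddCommGroup V] [NormedSpace ℝ V]
    (g : TotalSpace (Fin m → ℂ) E → V) : Prop :=
  ContMDiffOn (𝓘(ℝ, Fin n → ℂ).prod 𝓘(ℝ, Fin m → ℂ)) 𝓘(ℝ, V) ∞ g {w | w.2 ≠ 0}

open scoped ComplexOrder in
/-- `F : E → ℝ₊` is a complex Finsler function: smooth outside the zero section, homogeneous (the
degree is arbitrary; the usual choice is `F(λu) = |λ|² F(u)`), and strictly pseudoconvex, i.e. the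
matrix `h_{αβ̄}` is positive definite outside the zero section in all coordinates `(z, u)`. -/
structure IsFinslerFunction : Prop where
  smooth : SmoothOffZero (n := n) F
  nonneg : ∀ w, 0 ≤ F w
  homogeneous : ∃ r : ℝ, 0 < r ∧ ∀ (x : M) (u : E x) (c : ℂ), F ⟨x, c • u⟩ = ‖c‖ ^ r * F ⟨x, u⟩
  pseudoconvex : ∀ κ : HolCoords n m E, ∀ p ∈ κ.slit, (hMat κ F p).PosDef

end Local

end FinslerAlgebroid

end

open Bundle Set
open scoped Manifold ContDiff

noncomputable section

namespace FinslerAlgebroid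

/-! ### Coordinates on E: regularity of the point map and of the anchor -/

section Smoothness

variable {n m : ℕ} {M : Type*} [TopologicalSpace M] [ChartedSpace (Fin n → ℂ) M]
  {E : M → Type*} [TopologicalSpace (TotalSpace (Fin m → ℂ) E)]
  [∀ x, AddCommGroup (E x)] [∀ x, Module ℂ (E x)] [∀ x, TopologicalSpace (E x)]
  [FiberBundle (Fin m → ℂ) E]

/-! The metric pairs 𝒯'E with 𝒯''E nondegenerately, through the matrix h_{αβ̄} in each of the two
blocks of the adapted frame. Testing the gradient equation on the conjugate frame and contracting
with h^{γ̄α} therefore gives the gradient and its uniqueness (`isGradAt_iff`).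

For the divergence, let θ^i be the adapted coframe and let ℒ_Z θ^i = B_{ij} θ^j. Since d𝒱 is a
constant times h² times the wedge product of the θ^i, Jacobi's formula gives div Z = 2 Z(h)/h + tr B
(`isDivAt_iff_of_lieDeriv_coframe`). Uniqueness holds because d𝒱 does not vanish on the adapted
frame. Only the diagonal of B matters. For Z = g^α 𝒳_α the trace is δ_α g^α - g^α 𝒞_α - g^β ∂̇_α
N^α_β; for Z = g^α 𝒱_α it is ∂̇_α g^α.

Two identities finish the computation: ∂̇_α N^α_β = δ_β(log h) (`sum_du_connN`) and C_α = ∂̇_α(log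
h) (`trConnC_eq`). Both rest on the symmetry ∂̇_α h_{βσ̄} = ∂̇_β h_{ασ̄}. The factor h² produces two
copies of Z(log h), while the form (1/h) δ_α[h g^α] absorbs one. In the horizontal case the
nonlinear connection cancels the other; in the vertical case it survives as the term g^α C_α. -/

theorem HolCoords.isOpen_slit (κ : HolCoords n m E) : IsOpen κ.slit :=
  (κ.chart.open_target.preimage continuous_fst).inter
    (isOpen_compl_singleton.preimage continuous_snd)

omit [∀ x, AddCommGroup (E x)] [∀ x, Module ℂ (E x)] in
/-- A map into the total space which is `C^k` over `ℂ` is `C^k` over `ℝ`. -/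
theorem contMDiffWithinAt_real_of_complex {V : Type*} [NormedAddCommGroup V] [NormedSpace ℂ V]
    {g : V → TotalSpace (Fin m → ℂ) E} {s : Set V} {x : V} {k : ℕ∞ω}
    (hg : ContMDiffWithinAt 𝓘(ℂ, V) (𝓘(ℂ, Fin n → ℂ).prod 𝓘(ℂ, Fin m → ℂ)) k g s x) :
    ContMDiffWithinAt 𝓘(ℝ, V) (𝓘(ℝ, Fin n → ℂ).prod 𝓘(ℝ, Fin m → ℂ)) k g s x := by
  rw [contMDiffWithinAt_iff] at hg ⊢
  exact ⟨hg.1, hg.2.restrict_scalars ℝ⟩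

theorem HolCoords.contMDiffOn_chart_symm (κ : HolCoords n m E) :
    ContMDiffOn 𝓘(ℂ, Fin n → ℂ) 𝓘(ℂ, Fin n → ℂ) ω κ.chart.symm κ.chart.target :=
  contMDiffOn_symm_of_mem_maximalAtlas κ.chart_mem

theorem HolCoords.point_snd_ne_zero (κ : HolCoords n m E) {p : Coord n m} (hp : p ∈ κ.slit) :
    (κ.point p).2 ≠ 0 := fun h0 => hp.2 <| funext <|
  Fintype.linearIndependent_iff.1 (κ.isFrame.linearIndependent (κ.chart.map_target hp.1)) _ h0

variable [IsManifold 𝓘(ℂ, Fin n → ℂ) ω M]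

/-- The tangent map of the chart carries the holomorphic section ρ(e_α) of T'M to a section of the
tangent bundle of ℂⁿ, whose fibre component is the vector (ρ^k_α)_k. -/
theorem contDiffOn_rho (A : HolLieAlgebroid n m E) (κ : HolCoords n m E) (α : Fin m) :
    ContDiffOn ℂ ω (fun z k => rho A κ α k z) κ.chart.target := by
  have h1 : ContMDiffOn 𝓘(ℂ, Fin n → ℂ) 𝓘(ℂ, Fin n → ℂ).tangent ω
      (fun x => (⟨x, A.anchor x (κ.frame α x)⟩ : TangentBundle 𝓘(ℂ, Fin n → ℂ) M))
      κ.chart.source :=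
    A.anchor_hol _ _ κ.chart.open_source (κ.isFrame.contMDiffOn α)
  have h2 := (contMDiffOn_of_mem_maximalAtlas κ.chart_mem).contMDiffOn_tangentMapWithin
    (m := ω) le_rfl κ.chart.open_source.uniqueMDiffOn
  have h3 := h2.comp (h1.comp κ.contMDiffOn_chart_symm (fun z hz => κ.chart.map_target hz))
    (fun z hz => κ.chart.map_target hz)
  intro z hz
  have h4 : ContMDiffAt 𝓘(ℂ, Fin n → ℂ) 𝓘(ℂ, Fin n → ℂ).tangent ω
      (fun y => (⟨y, (fun k => rho A κ α k y : Fin n → ℂ)⟩ :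
        TangentBundle 𝓘(ℂ, Fin n → ℂ) (Fin n → ℂ))) z := by
    refine (h3.contMDiffAt (κ.chart.open_target.mem_nhds hz)).congr_of_eventuallyEq ?_
    filter_upwards [κ.chart.open_target.mem_nhds hz] with y hy
    have e1 : κ.chart (κ.chart.symm y) = y := κ.chart.right_inv hy
    simp only [Function.comp, tangentMapWithin,
      mfderivWithin_of_isOpen κ.chart.open_source (κ.chart.map_target hy)]
    exact TotalSpace.ext e1.symm HEq.rfl
  exact (contMDiffAt_vectorSpace_iff_contDiffAt.1 h4).contDiffWithinAt

variable [VectorBundle ℂ (Fin m → ℂ) E]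

omit [IsManifold 𝓘(ℂ, Fin n → ℂ) ω M] in
-- In a local trivialization, which is linear on fibres, u^α e_α(z) becomes a finite sum of products
-- of a coordinate u^α with a holomorphic map of z.
theorem HolCoords.contMDiffOn_point (κ : HolCoords n m E) :
    ContMDiffOn 𝓘(ℂ, Coord n m) (𝓘(ℂ, Fin n → ℂ).prod 𝓘(ℂ, Fin m → ℂ)) ω κ.point κ.slit := by
  intro p hp
  have hs : ContMDiffAt 𝓘(ℂ, Coord n m) 𝓘(ℂ, Fin n → ℂ) ω
      (fun q : Coord n m => κ.chart.symm q.1) p :=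
    ContMDiffAt.comp (I' := 𝓘(ℂ, Fin n → ℂ)) p
      (κ.contMDiffOn_chart_symm.contMDiffAt (κ.chart.open_target.mem_nhds hp.1))
      contDiff_fst.contMDiff.contMDiffAt
  have hsrc := κ.chart.map_target hp.1
  refine ContMDiffAt.contMDiffWithinAt ?_
  rw [contMDiffAt_totalSpace]
  refine ⟨hs, ?_⟩
  set e := trivializationAt (Fin m → ℂ) E (κ.point p).proj
  have hbase : (κ.point p).proj ∈ e.baseSet := FiberBundle.mem_baseSet_trivializationAt' _
  have hfr (α : Fin m) : ContMDiffAt 𝓘(ℂ, Coord n m) 𝓘(ℂ, Fin m → ℂ) ω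
      (fun q : Coord n m => (e ⟨κ.chart.symm q.1, κ.frame α (κ.chart.symm q.1)⟩).2) p := by
    have := (κ.isFrame.contMDiffAt κ.chart.open_source hsrc α)
    rw [contMDiffAt_section] at this
    exact ContMDiffAt.comp p (g := fun x => (e ⟨x, κ.frame α x⟩).2) this hs
  have hsum : ContMDiffAt 𝓘(ℂ, Coord n m) 𝓘(ℂ, Fin m → ℂ) ω
      (fun q : Coord n m => ∑ α, q.2 α •
        (e ⟨κ.chart.symm q.1, κ.frame α (κ.chart.symm q.1)⟩).2) p := by
    have h2 (α : Fin m) : ContDiffAt ℂ ω (fun q : Coord n m => q.2 α) p := by fun_prop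
    refine ContDiffAt.contMDiffAt (ContDiffAt.sum fun α _ => ?_)
    exact (h2 α).smul (hfr α).contDiffAt
  refine hsum.congr_of_eventuallyEq ?_
  filter_upwards [hs.continuousAt.preimage_mem_nhds (e.open_baseSet.mem_nhds hbase)] with q hq
  have hlin (v : E (κ.chart.symm q.1)) : (e ⟨κ.chart.symm q.1, v⟩).2
      = e.linearMapAt ℂ (κ.chart.symm q.1) v :=
    (congrFun (e.coe_linearMapAt_of_mem (R := ℂ) hq) v).symm
  simp only [HolCoords.point, hlin, map_sum, map_smul]

omit [IsManifold 𝓘(ℂ, Fin n → ℂ) ω M] in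
theorem SmoothOffZero.contDiffOn_comp_point {V : Type*} [NormedAddCommGroup V] [NormedSpace ℝ V]
    {g : TotalSpace (Fin m → ℂ) E → V} (hg : SmoothOffZero (n := n) g) (κ : HolCoords n m E) :
    ContDiffOn ℝ ∞ (fun p => g (κ.point p)) κ.slit := by
  have h : ContMDiffOn 𝓘(ℝ, Coord n m) (𝓘(ℝ, Fin n → ℂ).prod 𝓘(ℝ, Fin m → ℂ)) ∞
      κ.point κ.slit :=
    fun p hp => (contMDiffWithinAt_real_of_complex (κ.contMDiffOn_point p hp)).of_le le_top
  exact (ContMDiffOn.comp hg h fun p hp => κ.point_snd_ne_zero hp).contDiffOn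

end Smoothness

/-! ### Derivations along complex vectors, Jacobi's formula, commuting Wirtinger derivatives -/

section Calculus

variable {n m : ℕ}

/-- The linear form on real covectors which computes `wirt`. -/
def wirtForm (v : Coord n m) : (Coord n m →L[ℝ] ℂ) →ₗ[ℂ] ℂ where
  toFun D := (1 / 2) * (D v - Complex.I * D (Complex.I • v))
  map_add' D D' := by simp; ring
  map_smul' c D := by simp; ring

/-- The linear form on real covectors which computes `wirtBar`. -/
def wirtBarForm (v : Coord n m) : (Coord n m →L[ℝ] ℂ) →ₗ[ℂ] ℂ where
  toFun D := (1 / 2) * (D v + Complex.I * D (Complex.I • v))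
  map_add' D D' := by simp; ring
  map_smul' c D := by simp; ring

/-- The linear form on real covectors which computes `act`. -/
def actForm (v : TC n m) : (Coord n m →L[ℝ] ℂ) →ₗ[ℂ] ℂ :=
  (∑ k, v.1.1 k • wirtForm (Pi.single k 1, 0)) + (∑ α, v.1.2 α • wirtForm (0, Pi.single α 1))
    + (∑ k, v.2.1 k • wirtBarForm (Pi.single k 1, 0))
    + ∑ α, v.2.2 α • wirtBarForm (0, Pi.single α 1)

/-- A complex tangent vector acts through a ℂ-linear form in the real differential, so the sum and
product rules below are inherited from `fderiv`. -/
theorem act_eq_actForm (v : TC n m) (g : Coord n m → ℂ) (p : Coord n m) :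
    act v g p = actForm v (fderiv ℝ g p) := by
  simp [act, actForm, dz, dzBar, du, duBar, wirt, wirtBar, wirtForm, wirtBarForm]

variable {v : TC n m} {g g' : Coord n m → ℂ} {p : Coord n m}

theorem act_congr (h : g =ᶠ[nhds p] g') : act v g p = act v g' p := by
  rw [act_eq_actForm, act_eq_actForm, h.fderiv_eq]

theorem act_const (c : ℂ) : act v (fun _ => c) p = 0 := by
  simp [act_eq_actForm]

theorem act_neg : act v (fun q => - g q) p = - act v g p := by
  rw [act_eq_actForm, act_eq_actForm, fderiv_fun_neg, map_neg]

theorem act_add (hg : DifferentiableAt ℝ g p) (hg' : DifferentiableAt ℝ g' p) :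
    act v (fun q => g q + g' q) p = act v g p + act v g' p := by
  simp only [act_eq_actForm, fderiv_fun_add hg hg', map_add]

theorem act_mul (hg : DifferentiableAt ℝ g p) (hg' : DifferentiableAt ℝ g' p) :
    act v (fun q => g q * g' q) p = g p * act v g' p + g' p * act v g p := by
  simp only [act_eq_actForm, fderiv_fun_mul hg hg', map_add, map_smul, smul_eq_mul]

theorem act_sum {ι : Type*} {s : Finset ι} {g : ι → Coord n m → ℂ}
    (hg : ∀ i ∈ s, DifferentiableAt ℝ (g i) p) :
    act v (fun q => ∑ i ∈ s, g i q) p = ∑ i ∈ s, act v (g i) p := by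
  simp only [act_eq_actForm, fderiv_fun_sum hg, map_sum]

theorem act_prod {ι : Type*} [DecidableEq ι] {s : Finset ι} {g : ι → Coord n m → ℂ}
    (hg : ∀ i ∈ s, DifferentiableAt ℝ (g i) p) :
    act v (fun q => ∏ i ∈ s, g i q) p = ∑ i ∈ s, (∏ j ∈ s.erase i, g j p) * act v (g i) p := by
  simp only [act_eq_actForm, fderiv_finsetProd hg, map_sum, map_smul, smul_eq_mul]

/-- Each term expands along its replaced row, with the cofactors of `a` as coefficients. The sum
occurs both in the derivative of a determinant and in the bracket terms of ℒ_Z d𝒱. -/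
theorem _root_.Matrix.sum_det_updateRow {ι R : Type*} [Fintype ι] [DecidableEq ι] [CommRing R]
    (a w : Matrix ι ι R) : ∑ i, (a.updateRow i (w i)).det = (w * a.adjugate).trace := by
  refine Finset.sum_congr rfl fun i _ => ?_
  rw [Matrix.diag_apply, Matrix.mul_apply]
  have h : (a.updateRow i (w i)).det = Matrix.cramer a.transpose (w i) i := by
    rw [Matrix.cramer_transpose_apply]
  rw [h, Matrix.cramer_eq_adjugate_mulVec, Matrix.mulVec, dotProduct]
  simp [← Matrix.adjugate_transpose, mul_comm]

/-- Jacobi's formula. -/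
theorem act_det {ι : Type*} [Fintype ι] [DecidableEq ι] {a : Coord n m → Matrix ι ι ℂ}
    (ha : ∀ i j, DifferentiableAt ℝ (fun q => a q i j) p) :
    act v (fun q => (a q).det) p
      = ((Matrix.of fun i j => act v (fun q => a q i j) p) * (a p).adjugate).trace := by
  rw [← Matrix.sum_det_updateRow]
  simp only [Matrix.det_apply']
  have hprod (σ : Equiv.Perm ι) : DifferentiableAt ℝ (fun q => ∏ i, a q (σ i) i) p :=
    (HasFDerivAt.finsetProd fun i _ => (ha (σ i) i).hasFDerivAt).differentiableAt
  rw [act_sum fun σ _ => (hprod σ).const_mul _, Finset.sum_comm]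
  refine Finset.sum_congr rfl fun σ _ => ?_
  rw [act_mul (differentiableAt_const _) (hprod σ), act_const, mul_zero, add_zero, act_prod fun i _ => ha _ i, Finset.mul_sum]
  -- In the term of σ the factor with index i lies in row σ i, so the row to be replaced must be
  -- reindexed by σ.
  conv_rhs => rw [← Equiv.sum_comp σ]
  refine Finset.sum_congr rfl fun i _ => ?_
  congr 1
  rw [← Finset.mul_prod_erase _ _ (Finset.mem_univ i)]
  simp only [Matrix.updateRow_self, Matrix.of_apply]
  rw [mul_comm]
  congr 1
  refine Finset.prod_congr rfl fun j hj => ?_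
  rw [Matrix.updateRow_ne fun h => (Finset.ne_of_mem_erase hj) (σ.injective h)]

theorem du_eq_act (α : Fin m) : du α g p = act ((0, Pi.single α 1), 0) g p := by
  simp [act, Pi.single_apply]

/-- Both sides are the same constant combination of values of the second real derivative, which is
symmetric. -/
theorem wirt_comm (hg : ContDiffAt ℝ 2 g p) (v w : Coord n m) :
    wirt v (wirt w g) p = wirt w (wirt v g) p := by
  have hd : DifferentiableAt ℝ (fderiv ℝ g) p :=
    (hg.fderiv_right (m := 1) le_rfl).differentiableAt one_ne_zero
  have h (v w : Coord n m) : fderiv ℝ (wirt w g) p v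
      = (1 / 2) * (fderiv ℝ (fderiv ℝ g) p v w
        - Complex.I * fderiv ℝ (fderiv ℝ g) p v (Complex.I • w)) := by
    have hc (u : Coord n m) : HasFDerivAt (fun q => fderiv ℝ g q u)
        ((fderiv ℝ (fderiv ℝ g) p).flip u) p := by
      simpa using hd.hasFDerivAt.clm_apply (hasFDerivAt_const u p)
    have := ((hc w).sub ((hc (Complex.I • w)).const_mul Complex.I)).const_mul (1 / 2 : ℂ)
    rw [show fderiv ℝ (wirt w g) p = _ from HasFDerivAt.fderiv this]
    simp
  have hs : IsSymmSndFDerivAt ℝ g p := hg.isSymmSndFDerivAt (by simp)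
  simp only [wirt.eq_1 _ (wirt _ g), h]
  rw [hs v w, hs v (Complex.I • w), hs (Complex.I • v) w, hs (Complex.I • v) (Complex.I • w)]
  ring

theorem contDiffOn_wirt {s : Set (Coord n m)} (hs : IsOpen s) (hg : ContDiffOn ℝ ∞ g s)
    (v : Coord n m) : ContDiffOn ℝ ∞ (wirt v g) s := by
  have h := hg.fderiv_of_isOpen (m := ∞) hs le_rfl
  exact contDiffOn_const.mul ((h.clm_apply contDiffOn_const).sub
    (contDiffOn_const.mul (h.clm_apply contDiffOn_const)))

theorem contDiffOn_wirtBar {s : Set (Coord n m)} (hs : IsOpen s) (hg : ContDiffOn ℝ ∞ g s)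
    (v : Coord n m) : ContDiffOn ℝ ∞ (wirtBar v g) s := by
  have h := hg.fderiv_of_isOpen (m := ∞) hs le_rfl
  exact contDiffOn_const.mul ((h.clm_apply contDiffOn_const).add
    (contDiffOn_const.mul (h.clm_apply contDiffOn_const)))

theorem contDiffOn_star {s : Set (Coord n m)} (hg : ContDiffOn ℝ ∞ g s) :
    ContDiffOn ℝ ∞ (fun q => star (g q)) s :=
  Complex.conjCLE.contDiff.comp_contDiffOn hg

theorem contDiffOn_matrix_det {ι : Type*} [Fintype ι] [DecidableEq ι]
    {a : Coord n m → Matrix ι ι ℂ} {s : Set (Coord n m)}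
    (ha : ∀ i j, ContDiffOn ℝ ∞ (fun q => a q i j) s) : ContDiffOn ℝ ∞ (fun q => (a q).det) s := by
  simp only [Matrix.det_apply']
  exact ContDiffOn.sum fun σ _ => contDiffOn_const.mul (contDiffOn_prod fun i _ => ha _ _)

theorem contDiffOn_matrix_inv {ι : Type*} [Fintype ι] [DecidableEq ι]
    {a : Coord n m → Matrix ι ι ℂ} {s : Set (Coord n m)}
    (ha : ∀ i j, ContDiffOn ℝ ∞ (fun q => a q i j) s) (h0 : ∀ q ∈ s, (a q).det ≠ 0) (i j : ι) :
    ContDiffOn ℝ ∞ (fun q => (a q)⁻¹ i j) s := by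
  simp only [Matrix.inv_def, Ring.inverse_eq_inv', Matrix.smul_apply, smul_eq_mul,
    Matrix.adjugate_apply]
  refine ((contDiffOn_matrix_det ha).inv h0).mul (contDiffOn_matrix_det fun k l => ?_)
  by_cases h : k = j
  · subst h; simpa using contDiffOn_const
  · simpa [Matrix.updateRow_ne h] using ha k l

end Calculus

/-! ### Smoothness of the metric tensor and of the nonlinear connection -/

section Fields

variable {n m : ℕ} {M : Type*} [TopologicalSpace M] [ChartedSpace (Fin n → ℂ) M]
  [IsManifold 𝓘(ℂ, Fin n → ℂ) ω M]
  {E : M → Type*} [TopologicalSpace (TotalSpace (Fin m → ℂ) E)]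
  [∀ x, AddCommGroup (E x)] [∀ x, Module ℂ (E x)] [∀ x, TopologicalSpace (E x)]
  [FiberBundle (Fin m → ℂ) E]
  {A : HolLieAlgebroid n m E} {κ : HolCoords n m E} {F : TotalSpace (Fin m → ℂ) E → ℝ}

theorem contDiffOn_rho_slit (α : Fin m) (k : Fin n) :
    ContDiffOn ℝ ∞ (fun p : Coord n m => rho A κ α k p.1) κ.slit := by
  have h : ContDiffOn ℝ ∞ (fun z k => rho A κ α k z) κ.chart.target :=
    ((contDiffOn_rho A κ α).restrict_scalars ℝ).of_le le_top
  exact (contDiffOn_pi.1 h k).comp contDiff_fst.contDiffOn fun p hp => hp.1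

theorem du_rho {p : Coord n m} (hp : p ∈ κ.slit) (α β : Fin m) (k : Fin n) :
    du β (fun q => rho A κ α k q.1) p = 0 := by
  have h : DifferentiableAt ℂ (fun z => rho A κ α k z) p.1 :=
    (differentiableAt_pi.1 (((contDiffOn_rho A κ α).contDiffAt
      (κ.chart.open_target.mem_nhds hp.1)).differentiableAt (by simp))) k
  have h2 : HasFDerivAt (fun q : Coord n m => rho A κ α k q.1) _ p :=
    HasFDerivAt.comp p (h.restrictScalars ℝ).hasFDerivAt hasFDerivAt_fst
  simp [du, wirt, h2.fderiv]

theorem contDiffOn_dRho {g : Coord n m → ℂ} (hg : ContDiffOn ℝ ∞ g κ.slit) (α : Fin m) :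
    ContDiffOn ℝ ∞ (dRho A κ α g) κ.slit :=
  ContDiffOn.sum fun k _ => (contDiffOn_rho_slit α k).mul (contDiffOn_wirt κ.isOpen_slit hg _)

variable (hF : ContDiffOn ℝ ∞ (κ.pull fun w => (F w : ℂ)) κ.slit)
  (h0 : ∀ p ∈ κ.slit, hDet κ F p ≠ 0)

omit [IsManifold 𝓘(ℂ, Fin n → ℂ) ω M] in
include hF in
theorem contDiffOn_hMat (α β : Fin m) : ContDiffOn ℝ ∞ (fun p => hMat κ F p α β) κ.slit :=
  contDiffOn_wirt κ.isOpen_slit (contDiffOn_wirtBar κ.isOpen_slit hF _) _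

omit [IsManifold 𝓘(ℂ, Fin n → ℂ) ω M] in
include hF in
theorem contDiffOn_hDet : ContDiffOn ℝ ∞ (hDet κ F) κ.slit :=
  contDiffOn_matrix_det (contDiffOn_hMat hF)

omit [IsManifold 𝓘(ℂ, Fin n → ℂ) ω M] in
include hF h0 in
theorem contDiffOn_hInv (γ α : Fin m) : ContDiffOn ℝ ∞ (hInv κ F γ α) κ.slit :=
  contDiffOn_matrix_inv (contDiffOn_hMat hF) h0 γ α

include hF h0 in
theorem contDiffOn_connN (α β : Fin m) : ContDiffOn ℝ ∞ (connN A κ F α β) κ.slit :=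
  ContDiffOn.sum fun σ _ => (contDiffOn_hInv hF h0 σ β).mul
    (contDiffOn_dRho (contDiffOn_wirtBar κ.isOpen_slit hF _) α)

include hF h0 in
theorem contDiffOn_deltaBar {g : Coord n m → ℂ} (hg : ContDiffOn ℝ ∞ g κ.slit) (α : Fin m) :
    ContDiffOn ℝ ∞ (deltaBar A κ F α g) κ.slit :=
  (ContDiffOn.sum fun k _ => (contDiffOn_star (contDiffOn_rho_slit α k)).mul
    (contDiffOn_wirtBar κ.isOpen_slit hg _)).sub
  (ContDiffOn.sum fun β _ => (contDiffOn_star (contDiffOn_connN hF h0 α β)).mul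
    (contDiffOn_wirtBar κ.isOpen_slit hg _))

end Fields

/-! ### The adapted frame and the general divergence formula -/

section Divergence

variable {n m : ℕ} {M : Type*} [TopologicalSpace M] [ChartedSpace (Fin n → ℂ) M]
  [IsManifold 𝓘(ℂ, Fin n → ℂ) ω M]
  {E : M → Type*} [TopologicalSpace (TotalSpace (Fin m → ℂ) E)]
  [∀ x, AddCommGroup (E x)] [∀ x, Module ℂ (E x)] [∀ x, TopologicalSpace (E x)]
  [FiberBundle (Fin m → ℂ) E]
  {A : HolLieAlgebroid n m E} {κ : HolCoords n m E} {F : TotalSpace (Fin m → ℂ) E → ℝ}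

variable (A κ F) in
/-- The vector `(e_ᾱ, δ_ᾱ)` of the adapted frame, the conjugate of `frameX`. -/
def frameXBar (α : Fin m) (p : Coord n m) : EC m × TC n m :=
  ((0, Pi.single α 1),
    (0, (fun k => star (rho A κ α k p.1), fun β => - star (connN A κ F α β p))))

/-- The vector `(0, ∂̇_ᾱ)` of the adapted frame, the conjugate of `frameV`. -/
def frameVBar (α : Fin m) : EC m × TC n m := ((0, 0), (0, (0, Pi.single α 1)))

variable (A κ F) in
/-- The whole adapted frame. -/
def adaptedFrame (i : Idx m) (p : Coord n m) : EC m × TC n m :=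
  Sum.elim (Sum.elim (fun α => frameX A κ F α p) (fun α => frameXBar A κ F α p))
    (Sum.elim frameV frameVBar) i

variable (A κ F) in
/-- The derivatives along the vectors of the adapted frame. -/
def frameDeriv (g : Coord n m → ℂ) (p : Coord n m) : Idx m → ℂ :=
  Sum.elim (Sum.elim (fun α => delta A κ F α g p) (fun α => deltaBar A κ F α g p))
    (Sum.elim (fun α => du α g p) (fun α => duBar α g p))

theorem delta_eq_act (α : Fin m) (g : Coord n m → ℂ) (p : Coord n m) :
    delta A κ F α g p = act (frameX A κ F α p).2 g p := by
  simp [delta, dRho, frameX, act, sub_eq_add_neg, Finset.sum_neg_distrib]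

theorem coframe_adaptedFrame (i : Idx m) (p : Coord n m) :
    coframe A κ F p (adaptedFrame A κ F i p) = Pi.single i 1 := by
  ext j
  rcases i with ((i | i) | (i | i)) <;> rcases j with ((j | j) | (j | j)) <;>
    simp [coframe, adaptedFrame, coZ, coZBar, coV, coVBar, frameX, frameXBar, frameV, frameVBar,
      Pi.single_apply]

/-- The condition ρ_ℂ(e) = π_*(v) fixes the components along ∂_k and ∂_k̄, so a vector of the
prolongation is recovered from its values on the coframe. -/
theorem act_eq_sum_coframe {p : Coord n m} {ξ : EC m × TC n m} (hξ : ξ ∈ prolongation A κ p)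
    (g : Coord n m → ℂ) :
    act ξ.2 g p = ∑ i, frameDeriv A κ F g p i * coframe A κ F p ξ i := by
  obtain ⟨h1, h2⟩ := hξ
  have e1 : ∑ k, ξ.2.1.1 k * dz k g p = ∑ α, dRho A κ α g p * ξ.1.1 α := by
    simp only [← h1, dRho, Finset.sum_mul]
    rw [Finset.sum_comm]
    exact Finset.sum_congr rfl fun _ _ => Finset.sum_congr rfl fun _ _ => by ring
  have e2 : ∑ k, ξ.2.2.1 k * dzBar k g p
      = ∑ α, (∑ k, star (rho A κ α k p.1) * dzBar k g p) * ξ.1.2 α := by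
    simp only [← h2, Finset.sum_mul]
    rw [Finset.sum_comm]
    exact Finset.sum_congr rfl fun _ _ => Finset.sum_congr rfl fun _ _ => by ring
  have e3 : ∑ α, (∑ β, connN A κ F α β p * du β g p) * ξ.1.1 α
      = ∑ α, du α g p * ∑ β, connN A κ F β α p * ξ.1.1 β := by
    simp only [Finset.sum_mul, Finset.mul_sum]
    rw [Finset.sum_comm]
    exact Finset.sum_congr rfl fun _ _ => Finset.sum_congr rfl fun _ _ => by ring
  have e4 : ∑ α, (∑ β, star (connN A κ F α β p) * duBar β g p) * ξ.1.2 α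
      = ∑ α, duBar α g p * ∑ β, star (connN A κ F β α p) * ξ.1.2 β := by
    simp only [Finset.sum_mul, Finset.mul_sum]
    rw [Finset.sum_comm]
    exact Finset.sum_congr rfl fun _ _ => Finset.sum_congr rfl fun _ _ => by ring
  simp only [act, e1, e2, Fintype.sum_sum_type, frameDeriv, coframe, LinearMap.coe_mk,
    AddHom.coe_mk, Sum.elim_inl, Sum.elim_inr, coZ, coZBar, coV, coVBar, delta, deltaBar, sub_mul,
    mul_add, Finset.sum_sub_distrib, Finset.sum_add_distrib, e3, e4]
  simp only [mul_comm (du _ _ _) (ξ.2.1.2 _), mul_comm (duBar _ _ _) (ξ.2.2.2 _)]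
  ring

/-- The bracket is a first-order operator. Fields may thus be replaced by formulas valid only near
p, which is needed because the gradient is known explicitly only off the zero section. -/
theorem bracket_congr_left {Z Z' : Coord n m → EC m × TC n m} {p : Coord n m}
    (h : Z =ᶠ[nhds p] Z') (ξ : Coord n m → EC m × TC n m) :
    bracket A κ Z ξ p = bracket A κ Z' ξ p := by
  have key (v : TC n m) (φ : EC m × TC n m → ℂ) :
      act v (fun q => φ (Z q)) p = act v (fun q => φ (Z' q)) p := act_congr (h.fun_comp φ)
  have h1 v γ : act v (fun q => (Z q).1.1 γ) p = act v (fun q => (Z' q).1.1 γ) p :=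
    key v fun z => z.1.1 γ
  have h2 v γ : act v (fun q => (Z q).1.2 γ) p = act v (fun q => (Z' q).1.2 γ) p :=
    key v fun z => z.1.2 γ
  have h3 v k : act v (fun q => (Z q).2.1.1 k) p = act v (fun q => (Z' q).2.1.1 k) p :=
    key v fun z => z.2.1.1 k
  have h4 v γ : act v (fun q => (Z q).2.1.2 γ) p = act v (fun q => (Z' q).2.1.2 γ) p :=
    key v fun z => z.2.1.2 γ
  have h5 v k : act v (fun q => (Z q).2.2.1 k) p = act v (fun q => (Z' q).2.2.1 k) p :=
    key v fun z => z.2.2.1 k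
  have h6 v γ : act v (fun q => (Z q).2.2.2 γ) p = act v (fun q => (Z' q).2.2.2 γ) p :=
    key v fun z => z.2.2.2 γ
  simp only [bracket, fieldBracket, h.eq_of_nhds, h1, h2, h3, h4, h5, h6]

theorem isDivAt_congr {Z Z' : Coord n m → EC m × TC n m} {p : Coord n m}
    (h : Z =ᶠ[nhds p] Z') (d : ℂ) : IsDivAt A κ F Z p d ↔ IsDivAt A κ F Z' p d := by
  simp only [IsDivAt, lieDerivVol, bracket_congr_left h, h.eq_of_nhds]

theorem divergence_eq_of_isDivAt_iff {Z : Coord n m → EC m × TC n m} {p : Coord n m} {d : ℂ}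
    (h : ∀ d', IsDivAt A κ F Z p d' ↔ d' = d) : divergence A κ F Z p = d := by
  have hex : ∃ d', IsDivAt A κ F Z p d' := ⟨d, (h d).2 rfl⟩
  rw [divergence, dif_pos hex]
  exact (h _).1 hex.choose_spec

theorem volForm_apply (p : Coord n m) (ξ : Idx m → EC m × TC n m) :
    volForm A κ F p ξ = Complex.I ^ (2 * m ^ 2) * hDet κ F p ^ 2
      * (Matrix.of fun i => coframe A κ F p (ξ i)).det := rfl

theorem IsSmoothSection.differentiableAt {ξ : Coord n m → EC m × TC n m}
    (hξ : IsSmoothSection A κ ξ) {p : Coord n m} (hp : p ∈ κ.slit) : DifferentiableAt ℝ ξ p :=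
  (hξ.1.contDiffAt (κ.isOpen_slit.mem_nhds hp)).differentiableAt (by simp)

omit [IsManifold 𝓘(ℂ, Fin n → ℂ) ω M] in
theorem differentiableAt_of_contDiffOn_slit {g : Coord n m → ℂ} (hg : ContDiffOn ℝ ∞ g κ.slit)
    {p : Coord n m} (hp : p ∈ κ.slit) : DifferentiableAt ℝ g p :=
  (hg.contDiffAt (κ.isOpen_slit.mem_nhds hp)).differentiableAt (by simp)

theorem coframe_differentiableAt (hN : ∀ α β, ContDiffOn ℝ ∞ (connN A κ F α β) κ.slit)
    {ξ : Coord n m → EC m × TC n m} (hξ : IsSmoothSection A κ ξ) {p : Coord n m}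
    (hp : p ∈ κ.slit) (j : Idx m) :
    DifferentiableAt ℝ (fun q => coframe A κ F q (ξ q) j) p := by
  have hd := hξ.differentiableAt hp
  have hNd (α β : Fin m) := differentiableAt_of_contDiffOn_slit (hN α β) hp
  have hNs (α β : Fin m) := differentiableAt_of_contDiffOn_slit (contDiffOn_star (hN α β)) hp
  rcases j with ((j | j) | (j | j)) <;>
    simp only [coframe, coZ, coZBar, coV, coVBar, LinearMap.coe_mk, AddHom.coe_mk, Sum.elim_inl,
      Sum.elim_inr] <;> fun_prop

theorem isSmoothSection_adaptedFrame (hN : ∀ α β, ContDiffOn ℝ ∞ (connN A κ F α β) κ.slit)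
    (i : Idx m) : IsSmoothSection A κ (adaptedFrame A κ F i) := by
  constructor
  · rcases i with ((i | i) | (i | i))
    · exact contDiffOn_const.prodMk (((contDiffOn_pi.2 fun k => contDiffOn_rho_slit i k).prodMk
        (contDiffOn_pi.2 fun β => (hN i β).neg)).prodMk contDiffOn_const)
    · exact contDiffOn_const.prodMk (contDiffOn_const.prodMk
        ((contDiffOn_pi.2 fun k => contDiffOn_star (contDiffOn_rho_slit i k)).prodMk
        (contDiffOn_pi.2 fun β => (contDiffOn_star (hN i β)).neg)))
    · exact contDiffOn_const
    · exact contDiffOn_const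
  · intro p _
    rcases i with ((i | i) | (i | i)) <;>
      simp [prolongation, adaptedFrame, frameX, frameXBar, frameV, frameVBar, Pi.single_apply]

/-- The divergence of `Z` in terms of the matrix of `ℒ_Z` acting on the adapted coframe. -/
theorem isDivAt_iff_of_lieDeriv_coframe (hN : ∀ α β, ContDiffOn ℝ ∞ (connN A κ F α β) κ.slit)
    {Z : Coord n m → EC m × TC n m} {p : Coord n m} (hp : p ∈ κ.slit)
    (hd : DifferentiableAt ℝ (hDet κ F) p) (h0 : hDet κ F p ≠ 0) (B : Matrix (Idx m) (Idx m) ℂ)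
    (hB : ∀ ξ, IsSmoothSection A κ ξ → ∀ i,
      act (Z p).2 (fun q => coframe A κ F q (ξ q) i) p - coframe A κ F p (bracket A κ Z ξ p) i
        = ∑ j, B i j * coframe A κ F p (ξ p) j) (d : ℂ) :
    IsDivAt A κ F Z p d ↔ d = 2 * act (Z p).2 (hDet κ F) p / hDet κ F p + B.trace := by
  set c : ℂ := Complex.I ^ (2 * m ^ 2)
  set d₀ := 2 * act (Z p).2 (hDet κ F) p / hDet κ F p + B.trace
  have key : IsDivAt A κ F Z p d₀ := by
    intro ξ hξ
    -- The i-th row of `a` holds the coframe values of ξ_i, that of `w` those of [Z, ξ_i]; hence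
    -- d𝒱(ξ) = c h² det a, and a bracket replaces one row of `a` by a row of `w`.
    let a : Coord n m → Matrix (Idx m) (Idx m) ℂ :=
      fun q => Matrix.of fun i => coframe A κ F q (ξ i q)
    let w : Matrix (Idx m) (Idx m) ℂ :=
      Matrix.of fun i => coframe A κ F p (bracket A κ Z (ξ i) p)
    have ha (i j : Idx m) : DifferentiableAt ℝ (fun q => a q i j) p :=
      coframe_differentiableAt hN (hξ i) hp j
    have hdet : DifferentiableAt ℝ (fun q => (a q).det) p := by
      simp only [Matrix.det_apply']
      exact DifferentiableAt.fun_sum fun σ _ => DifferentiableAt.const_mul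
        (HasFDerivAt.finsetProd fun i _ => (ha (σ i) i).hasFDerivAt).differentiableAt _
    have hup (i : Idx m) :
        volForm A κ F p (Function.update (fun j => ξ j p) i (bracket A κ Z (ξ i) p))
          = c * hDet κ F p ^ 2 * ((a p).updateRow i (w i)).det := by
      rw [volForm_apply]
      congr 2
      ext j k
      by_cases hji : j = i
      · subst hji; simp [w]
      · simp [a, hji]
    have hmat : (Matrix.of fun i j => act (Z p).2 (fun q => a q i j) p) - w
        = a p * B.transpose := by
      ext i j
      simp only [Matrix.sub_apply, Matrix.of_apply, Matrix.mul_apply, Matrix.transpose_apply, a, w,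
        hB (ξ i) (hξ i) j]
      exact Finset.sum_congr rfl fun _ _ => mul_comm _ _
    -- As Z(a) - w = a Bᵀ, cyclicity of the trace and adj(a) a = det(a) reduce the difference to
    -- tr(B) det(a).
    have htr : ((Matrix.of fun i j => act (Z p).2 (fun q => a q i j) p) * (a p).adjugate).trace
        - (w * (a p).adjugate).trace = B.trace * (a p).det := by
      rw [← Matrix.trace_sub, ← Matrix.sub_mul, hmat, Matrix.trace_mul_comm, ← Matrix.mul_assoc,
        Matrix.adjugate_mul]
      simp [mul_comm]
    have hact : act (Z p).2 (fun q => volForm A κ F q fun i => ξ i q) p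
        = c * (2 * hDet κ F p * act (Z p).2 (hDet κ F) p * (a p).det + hDet κ F p ^ 2 *
          ((Matrix.of fun i j => act (Z p).2 (fun q => a q i j) p) * (a p).adjugate).trace) := by
      have : (fun q => volForm A κ F q fun i => ξ i q)
          = fun q => c * ((hDet κ F q * hDet κ F q) * (a q).det) := by
        funext q; rw [volForm_apply]; simp only [c, a]; ring
      rw [this, act_mul (differentiableAt_const c) ((hd.fun_mul hd).fun_mul hdet), act_const,
        act_mul (hd.fun_mul hd) hdet, act_mul hd hd, act_det ha]
      ring
    rw [lieDerivVol, hact, Finset.sum_congr rfl fun i _ => hup i, ← Finset.mul_sum,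
      Matrix.sum_det_updateRow, volForm_apply]
    change _ = d₀ * (c * hDet κ F p ^ 2 * (a p).det)
    have : d₀ * hDet κ F p = 2 * act (Z p).2 (hDet κ F) p + B.trace * hDet κ F p := by
      simp only [d₀]; field_simp
    linear_combination c * hDet κ F p ^ 2 * htr - c * hDet κ F p * (a p).det * this
  refine ⟨fun h => ?_, fun h => h ▸ key⟩
  -- On the adapted frame d𝒱 equals i^{2m²} h², which is nonzero, so the divergence is determined.
  have h1 := h _ fun i => isSmoothSection_adaptedFrame hN i
  rw [key _ fun i => isSmoothSection_adaptedFrame hN i] at h1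
  refine (mul_right_cancel₀ ?_ h1).symm
  have hone : (Matrix.of fun i => coframe A κ F p (adaptedFrame A κ F i p)) = 1 := by
    ext i j
    simp [coframe_adaptedFrame, Matrix.one_apply, Pi.single_apply, eq_comm]
  rw [volForm_apply, hone, Matrix.det_one]
  simpa using h0

end Divergence

/-! ### Divergences of horizontal and vertical fields -/

section Fields

variable {n m : ℕ} {M : Type*} [TopologicalSpace M] [ChartedSpace (Fin n → ℂ) M]
  [IsManifold 𝓘(ℂ, Fin n → ℂ) ω M]
  {E : M → Type*} [TopologicalSpace (TotalSpace (Fin m → ℂ) E)]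
  [∀ x, AddCommGroup (E x)] [∀ x, Module ℂ (E x)] [∀ x, TopologicalSpace (E x)]
  [FiberBundle (Fin m → ℂ) E]
  {A : HolLieAlgebroid n m E} {κ : HolCoords n m E} {F : TotalSpace (Fin m → ℂ) E → ℝ}

theorem act_sum_smul {ι : Type*} {s : Finset ι} (c : ι → ℂ) (ξ : ι → EC m × TC n m)
    (g : Coord n m → ℂ) (p : Coord n m) :
    act (∑ i ∈ s, c i • ξ i).2 g p = ∑ i ∈ s, c i * act (ξ i).2 g p := by
  let L : (EC m × TC n m) →ₗ[ℂ] ℂ :=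
    { toFun := fun ξ => act ξ.2 g p
      map_add' := fun a b => by simp [act, add_mul, Finset.sum_add_distrib]; ring
      map_smul' := fun c a => by simp [act, mul_assoc, ← Finset.mul_sum, mul_add] }
  exact (map_sum L _ s).trans (Finset.sum_congr rfl fun i _ => map_smul L (c i) (ξ i))

theorem sum_smul_frameX (c : Fin m → ℂ) (p : Coord n m) :
    ∑ α, c α • frameX A κ F α p
      = ((c, 0), ((fun k => ∑ α, c α * rho A κ α k p.1,
          fun β => - ∑ α, c α * connN A κ F α β p), 0)) := by
  ext i <;> simp [frameX, Prod.fst_sum, Prod.snd_sum, Pi.single_apply, Finset.sum_apply]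

theorem sum_smul_frameV (c : Fin m → ℂ) :
    ∑ α, c α • (frameV α : EC m × TC n m) = ((0, 0), ((0, c), 0)) := by
  ext i <;> simp [frameV, Prod.fst_sum, Prod.snd_sum, Pi.single_apply, Finset.sum_apply]

theorem coframe_inl_inl (p : Coord n m) (ξ : EC m × TC n m) (α : Fin m) :
    coframe A κ F p ξ (.inl (.inl α)) = ξ.1.1 α := rfl

theorem coframe_inl_inr (p : Coord n m) (ξ : EC m × TC n m) (α : Fin m) :
    coframe A κ F p ξ (.inl (.inr α)) = ξ.1.2 α := rfl

theorem coframe_inr_inl (p : Coord n m) (ξ : EC m × TC n m) (α : Fin m) :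
    coframe A κ F p ξ (.inr (.inl α)) = ξ.2.1.2 α + ∑ β, connN A κ F β α p * ξ.1.1 β := rfl

theorem coframe_inr_inr (p : Coord n m) (ξ : EC m × TC n m) (α : Fin m) :
    coframe A κ F p ξ (.inr (.inr α)) = ξ.2.2.2 α + ∑ β, star (connN A κ F β α p) * ξ.1.2 β := rfl

/-- The derivative of `δ𝒱^α(ξ)` along a tangent vector. -/
theorem act_coV (hN : ∀ α β, ContDiffOn ℝ ∞ (connN A κ F α β) κ.slit)
    {ξ : Coord n m → EC m × TC n m} (hξ : IsSmoothSection A κ ξ) {p : Coord n m}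
    (hp : p ∈ κ.slit) (v : TC n m) (α : Fin m) :
    act v (fun q => coframe A κ F q (ξ q) (.inr (.inl α))) p
      = act v (fun q => (ξ q).2.1.2 α) p
        + ∑ β, (connN A κ F β α p * act v (fun q => (ξ q).1.1 β) p
          + (ξ p).1.1 β * act v (connN A κ F β α) p) := by
  have hd := hξ.differentiableAt hp
  have hNd (α β : Fin m) := differentiableAt_of_contDiffOn_slit (hN α β) hp
  have h1 (β : Fin m) : DifferentiableAt ℝ (fun q => (ξ q).1.1 β) p := by fun_prop
  simp only [coframe_inr_inl]
  rw [act_add (by fun_prop) (by fun_prop), act_sum fun β _ => (hNd β α).fun_mul (h1 β)]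
  simp only [act_mul (hNd _ α) (h1 _)]

/-- The derivative of `δ𝒱^ᾱ(ξ)` along a tangent vector. -/
theorem act_coVBar (hN : ∀ α β, ContDiffOn ℝ ∞ (connN A κ F α β) κ.slit)
    {ξ : Coord n m → EC m × TC n m} (hξ : IsSmoothSection A κ ξ) {p : Coord n m}
    (hp : p ∈ κ.slit) (v : TC n m) (α : Fin m) :
    act v (fun q => coframe A κ F q (ξ q) (.inr (.inr α))) p
      = act v (fun q => (ξ q).2.2.2 α) p
        + ∑ β, (star (connN A κ F β α p) * act v (fun q => (ξ q).1.2 β) p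
          + (ξ p).1.2 β * act v (fun q => star (connN A κ F β α q)) p) := by
  have hd := hξ.differentiableAt hp
  have hNd (α β : Fin m) := differentiableAt_of_contDiffOn_slit (contDiffOn_star (hN α β)) hp
  have h1 (β : Fin m) : DifferentiableAt ℝ (fun q => (ξ q).1.2 β) p := by fun_prop
  simp only [coframe_inr_inr]
  rw [act_add (by fun_prop) (by fun_prop), act_sum fun β _ => (hNd β α).fun_mul (h1 β)]
  simp only [act_mul (hNd _ α) (h1 _)]

theorem sum_elim_mul_coframe (c : Fin m → ℂ) (p : Coord n m) (ξ : EC m × TC n m) :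
    ∑ j, (Sum.elim (Sum.elim c 0) 0 : Idx m → ℂ) j * coframe A κ F p ξ j
      = ∑ β, c β * ξ.1.1 β := by
  simp [Fintype.sum_sum_type, coframe_inl_inl]

theorem sum_elim_bar_mul_coframe (c : Fin m → ℂ) (p : Coord n m) (ξ : EC m × TC n m) :
    ∑ j, (Sum.elim (Sum.elim 0 c) 0 : Idx m → ℂ) j * coframe A κ F p ξ j
      = ∑ β, c β * ξ.1.2 β := by
  simp [Fintype.sum_sum_type, coframe_inl_inr]

/-- The divergence of a horizontal field. -/
theorem isDivAt_sum_smul_frameX (hN : ∀ α β, ContDiffOn ℝ ∞ (connN A κ F α β) κ.slit)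
    {p : Coord n m} (hp : p ∈ κ.slit) (hd : DifferentiableAt ℝ (hDet κ F) p)
    (h0 : hDet κ F p ≠ 0) {g : Fin m → Coord n m → ℂ} (hg : ∀ α, DifferentiableAt ℝ (g α) p)
    (d : ℂ) :
    IsDivAt A κ F (fun q => ∑ α, g α q • frameX A κ F α q) p d ↔
      d = 2 * (∑ α, g α p * delta A κ F α (hDet κ F) p) / hDet κ F p
        + (∑ α, delta A κ F α (g α) p - ∑ α, g α p * trC A κ α p
          - ∑ β, g β p * ∑ α, du α (connN A κ F β α) p) := by
  set Z : Coord n m → EC m × TC n m := fun q => ∑ α, g α q • frameX A κ F α q with hZdef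
  have hZ (q : Coord n m) : Z q = ((fun α => g α q, 0), ((fun k => ∑ α, g α q * rho A κ α k q.1,
      fun β => - ∑ α, g α q * connN A κ F α β q), 0)) := sum_smul_frameX _ q
  have hNd (α β : Fin m) := differentiableAt_of_contDiffOn_slit (hN α β) hp
  have hact (f : Coord n m → ℂ) : act (Z p).2 f p = ∑ α, g α p * delta A κ F α f p := by
    simp only [hZdef, act_sum_smul, delta_eq_act]
  -- The rows are ℒ_Z of 𝒵^γ, 𝒵^γ̄, δ𝒱^α, δ𝒱^ᾱ, in this order. The second block is zero and the
  -- fourth has entries only in the 𝒵^β̄ columns, so neither contributes to the trace.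
  rw [isDivAt_iff_of_lieDeriv_coframe hN hp hd h0 (Matrix.of (Sum.elim
    (Sum.elim
      (fun γ j => frameDeriv A κ F (g γ) p j - (Sum.elim (Sum.elim
        (fun β => ∑ α, strC A κ γ α β p.1 * g α p) 0) 0 : Idx m → ℂ) j) 0)
    (Sum.elim
      (fun α j => (Sum.elim (Sum.elim (fun ν => act (Z p).2 (connN A κ F ν α) p
          - ∑ β, connN A κ F β α p * ∑ μ, strC A κ β μ ν p.1 * g μ p) 0) 0 : Idx m → ℂ) j
        - ∑ μ, g μ p * frameDeriv A κ F (connN A κ F μ α) p j)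
      (fun α => Sum.elim (Sum.elim 0
        (fun β => act (Z p).2 (fun q => star (connN A κ F β α q)) p)) 0))))]
  · rw [hact]
    refine Eq.congr_right (congrArg _ ?_)
    simp only [Matrix.trace, Matrix.diag_apply, Matrix.of_apply, Fintype.sum_sum_type, Sum.elim_inl,
      Sum.elim_inr, frameDeriv, Pi.zero_apply, Finset.sum_const_zero, add_zero, trC,
      Finset.sum_sub_distrib, zero_sub, Finset.sum_neg_distrib, Finset.mul_sum]
    rw [Finset.sum_comm (f := fun γ α => strC A κ γ α γ p.1 * g α p),
      Finset.sum_comm (f := fun α μ => g μ p * du α (connN A κ F μ α) p)]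
    simp only [mul_comm (strC _ _ _ _ _ _)]
    ring
  · intro ξ hξ i
    have hprol := hξ.2 p hp
    have hsum (c : Fin m → ℂ) (f : Fin m → Coord n m → ℂ) :
        ∑ j, (∑ μ, c μ * frameDeriv A κ F (f μ) p j) * coframe A κ F p (ξ p) j
          = ∑ μ, c μ * act (ξ p).2 (f μ) p := by
      simp only [act_eq_sum_coframe (F := F) hprol, Finset.sum_mul, Finset.mul_sum]
      rw [Finset.sum_comm]
      exact Finset.sum_congr rfl fun _ _ => Finset.sum_congr rfl fun _ _ => by ring
    rcases i with ((γ | γ) | (γ | γ))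
    · simp only [coframe_inl_inl, bracket, hZ, Matrix.of_apply, Sum.elim_inl, sub_mul,
        Finset.sum_sub_distrib, sum_elim_mul_coframe, ← act_eq_sum_coframe hprol, Finset.sum_mul]
      rw [Finset.sum_comm (f := fun β α => strC A κ γ α β p.1 * g α p * (ξ p).1.1 β)]
      ring
    · simp [coframe_inl_inr, bracket, hZ, act_const]
    -- The vertical component of Z is -g^μ N_μ^γ. The terms N_μ^γ ξ(g^μ) it yields cancel those of
    -- N_μ^γ 𝒵^μ([Z, ξ]), leaving no derivative of g in this row.
    · have hv : act (ξ p).2 (fun q => - ∑ α, g α q * connN A κ F α γ q) p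
          = - ∑ μ, (g μ p * act (ξ p).2 (connN A κ F μ γ) p
            + connN A κ F μ γ p * act (ξ p).2 (g μ) p) := by
        rw [act_neg, act_sum fun μ _ => (hg μ).fun_mul (hNd μ γ)]
        simp only [act_mul (hg _) (hNd _ γ)]
      have hC : ∑ ν, (∑ β, connN A κ F β γ p * ∑ μ, strC A κ β μ ν p.1 * g μ p) * (ξ p).1.1 ν
          = ∑ β, connN A κ F β γ p *
            ∑ μ, ∑ ν, strC A κ β μ ν p.1 * g μ p * (ξ p).1.1 ν := by
        simp only [Finset.sum_mul, Finset.mul_sum, mul_assoc]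
        rw [Finset.sum_comm]
        exact Finset.sum_congr rfl fun _ _ => Finset.sum_comm
      rw [act_coV hN hξ hp]
      simp only [coframe_inr_inl, bracket, fieldBracket, Matrix.of_apply, Sum.elim_inl, Sum.elim_inr,
        sub_mul, Finset.sum_sub_distrib, sum_elim_mul_coframe, hsum, hC]
      simp only [hZ, hv, mul_add, mul_sub, Finset.sum_add_distrib, Finset.sum_sub_distrib]
      simp only [mul_comm (act _ _ _) ((ξ p).1.1 _)]
      ring
    · rw [act_coVBar hN hξ hp]
      simp only [coframe_inr_inr, bracket, fieldBracket, Matrix.of_apply, Sum.elim_inr,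
        sum_elim_bar_mul_coframe]
      simp only [hZ, Prod.snd_zero, Pi.zero_apply, act_const, mul_zero, zero_mul,
        sub_zero, Finset.sum_const_zero, add_zero, Finset.sum_add_distrib]
      simp only [mul_comm (act _ _ _) ((ξ p).1.2 _)]
      ring

/-- The divergence of a vertical field. -/
theorem isDivAt_sum_smul_frameV (hN : ∀ α β, ContDiffOn ℝ ∞ (connN A κ F α β) κ.slit)
    {p : Coord n m} (hp : p ∈ κ.slit) (hd : DifferentiableAt ℝ (hDet κ F) p)
    (h0 : hDet κ F p ≠ 0) {g : Fin m → Coord n m → ℂ} (d : ℂ) :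
    IsDivAt A κ F (fun q => ∑ α, g α q • frameV α) p d ↔
      d = 2 * (∑ α, g α p * du α (hDet κ F) p) / hDet κ F p + ∑ α, du α (g α) p := by
  set Z : Coord n m → EC m × TC n m := fun q => ∑ α, g α q • frameV α with hZdef
  have hZ (q : Coord n m) : Z q = ((0, 0), ((0, fun α => g α q), 0)) := sum_smul_frameV _
  have hact (f : Coord n m → ℂ) : act (Z p).2 f p = ∑ α, g α p * du α f p := by
    simp only [hZdef, act_sum_smul, du_eq_act]; rfl
  -- Z has no component in E_ℂ, so ℒ_Z kills 𝒵^γ and 𝒵^γ̄. The derivatives of N enter only in the 𝒵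
  -- and 𝒵̄ columns, off the diagonal.
  rw [isDivAt_iff_of_lieDeriv_coframe hN hp hd h0 (Matrix.of (Sum.elim 0
    (Sum.elim
      (fun α j => (Sum.elim (Sum.elim (fun ν => act (Z p).2 (connN A κ F ν α) p) 0) 0 :
        Idx m → ℂ) j + frameDeriv A κ F (g α) p j)
      (fun α => Sum.elim (Sum.elim 0
        (fun β => act (Z p).2 (fun q => star (connN A κ F β α q)) p)) 0))))]
  · rw [hact]
    simp [Matrix.trace, Fintype.sum_sum_type, frameDeriv]
  · intro ξ hξ i
    have hprol := hξ.2 p hp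
    rcases i with ((γ | γ) | (γ | γ))
    · simp [coframe_inl_inl, bracket, hZ, act_const]
    · simp [coframe_inl_inr, bracket, hZ, act_const]
    · rw [act_coV hN hξ hp]
      simp only [coframe_inr_inl, bracket, fieldBracket, Matrix.of_apply, Sum.elim_inl, Sum.elim_inr,
        add_mul, Finset.sum_add_distrib, sum_elim_mul_coframe, ← act_eq_sum_coframe hprol]
      simp only [hZ, Pi.zero_apply, act_const, mul_zero, zero_mul,
        sub_zero, Finset.sum_const_zero, add_zero]
      simp only [mul_comm (act _ _ _) ((ξ p).1.1 _)]
      ring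
    · rw [act_coVBar hN hξ hp]
      simp only [coframe_inr_inr, bracket, fieldBracket, Matrix.of_apply, Sum.elim_inr,
        sum_elim_bar_mul_coframe]
      simp only [hZ, Prod.snd_zero, Pi.zero_apply, act_const, mul_zero, zero_mul,
        sub_zero, Finset.sum_const_zero, add_zero, Finset.sum_add_distrib]
      simp only [mul_comm (act _ _ _) ((ξ p).1.2 _)]
      ring

end Fields

/-! ### Metric identities, the gradient and the Laplacians -/

section Laplacians

variable {n m : ℕ} {M : Type*} [TopologicalSpace M] [ChartedSpace (Fin n → ℂ) M]
  [IsManifold 𝓘(ℂ, Fin n → ℂ) ω M]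
  {E : M → Type*} [TopologicalSpace (TotalSpace (Fin m → ℂ) E)]
  [∀ x, AddCommGroup (E x)] [∀ x, Module ℂ (E x)] [∀ x, TopologicalSpace (E x)]
  [FiberBundle (Fin m → ℂ) E]
  {A : HolLieAlgebroid n m E} {κ : HolCoords n m E} {F : TotalSpace (Fin m → ℂ) E → ℝ}
  {f : TotalSpace (Fin m → ℂ) E → ℂ}

omit [IsManifold 𝓘(ℂ, Fin n → ℂ) ω M] in
theorem sum_hInv_mul_hMat {p : Coord n m} (h0 : hDet κ F p ≠ 0) (σ τ : Fin m) :
    ∑ μ, hInv κ F σ μ p * hMat κ F p μ τ = if σ = τ then 1 else 0 := by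
  have := congrFun₂ (Matrix.nonsing_inv_mul (hMat κ F p) (isUnit_iff_ne_zero.2 h0)) σ τ
  rwa [Matrix.mul_apply, Matrix.one_apply] at this

omit [IsManifold 𝓘(ℂ, Fin n → ℂ) ω M] in
theorem sum_hMat_mul_hInv {p : Coord n m} (h0 : hDet κ F p ≠ 0) (σ τ : Fin m) :
    ∑ μ, hMat κ F p σ μ * hInv κ F μ τ p = if σ = τ then 1 else 0 := by
  have := congrFun₂ (Matrix.mul_nonsing_inv (hMat κ F p) (isUnit_iff_ne_zero.2 h0)) σ τ
  rwa [Matrix.mul_apply, Matrix.one_apply] at this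

omit [IsManifold 𝓘(ℂ, Fin n → ℂ) ω M] in
theorem sum_mul_hInv_mul_hMat {p : Coord n m} (h0 : hDet κ F p ≠ 0) (c : Fin m → ℂ) (β : Fin m) :
    ∑ α, hMat κ F p α β * ∑ γ, hInv κ F γ α p * c γ = c β := by
  have h : ∑ α, hMat κ F p α β * ∑ γ, hInv κ F γ α p * c γ
      = ∑ γ, (∑ α, hInv κ F γ α p * hMat κ F p α β) * c γ := by
    simp only [Finset.mul_sum, Finset.sum_mul]
    rw [Finset.sum_comm]
    exact Finset.sum_congr rfl fun _ _ => Finset.sum_congr rfl fun _ _ => by ring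
  simp [h, sum_hInv_mul_hMat h0]

omit [IsManifold 𝓘(ℂ, Fin n → ℂ) ω M] in
theorem sum_hInv_mul_sum_hMat {p : Coord n m} (h0 : hDet κ F p ≠ 0) (c : Fin m → ℂ) (α : Fin m) :
    ∑ γ, hInv κ F γ α p * ∑ μ, hMat κ F p μ γ * c μ = c α := by
  have h : ∑ γ, hInv κ F γ α p * ∑ μ, hMat κ F p μ γ * c μ
      = ∑ μ, (∑ γ, hMat κ F p μ γ * hInv κ F γ α p) * c μ := by
    simp only [Finset.mul_sum, Finset.sum_mul]
    rw [Finset.sum_comm]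
    exact Finset.sum_congr rfl fun _ _ => Finset.sum_congr rfl fun _ _ => by ring
  simp [h, sum_hMat_mul_hInv h0]

omit [IsManifold 𝓘(ℂ, Fin n → ℂ) ω M] in
open scoped ComplexOrder in
theorem IsFinslerFunction.hDet_ne_zero (hF : IsFinslerFunction (n := n) F) {p : Coord n m}
    (hp : p ∈ κ.slit) : hDet κ F p ≠ 0 :=
  (hF.pseudoconvex κ p hp).det_pos.ne'

/-! ### Derivatives of the metric tensor -/

omit [IsManifold 𝓘(ℂ, Fin n → ℂ) ω M] in
/-- The logarithmic derivative of `h = det (h_{αβ̄})`. -/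
theorem act_hDet_div {p : Coord n m}
    (hH : ∀ i j, DifferentiableAt ℝ (fun q => hMat κ F q i j) p) (v : TC n m) :
    act v (hDet κ F) p / hDet κ F p
      = ∑ α, ∑ σ, hInv κ F σ α p * act v (fun q => hMat κ F q α σ) p := by
  have h1 : act v (hDet κ F) p = _ := act_det hH
  rw [h1, Matrix.trace, Finset.sum_div]
  refine Finset.sum_congr rfl fun α _ => ?_
  rw [Matrix.diag_apply, Matrix.mul_apply, Finset.sum_div]
  refine Finset.sum_congr rfl fun σ _ => ?_
  rw [hInv, Matrix.inv_def, Ring.inverse_eq_inv', Matrix.smul_apply, smul_eq_mul, Matrix.of_apply,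
    hDet]
  ring

omit [IsManifold 𝓘(ℂ, Fin n → ℂ) ω M] in
-- For fixed σ, the entries h_{ασ̄} are the derivatives ∂̇_α of the single function ∂̇_σ̄ F.
theorem du_hMat_comm (hF : ContDiffOn ℝ ∞ (κ.pull fun w => (F w : ℂ)) κ.slit) {p : Coord n m}
    (hp : p ∈ κ.slit) (α β σ : Fin m) :
    du α (fun q => hMat κ F q β σ) p = du β (fun q => hMat κ F q α σ) p := by
  have h := (contDiffOn_wirtBar κ.isOpen_slit hF (0, Pi.single σ 1)).contDiffAt
    (κ.isOpen_slit.mem_nhds hp)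
  exact wirt_comm (contDiffAt_infty.1 h 2) _ _

omit [IsManifold 𝓘(ℂ, Fin n → ℂ) ω M] in
-- The symmetry of ∂̇_β h_{ασ̄} in α and β turns C_α into h^{σ̄β} ∂̇_α h_{βσ̄}, the logarithmic
-- derivative of the determinant.
theorem trConnC_eq (hF : ContDiffOn ℝ ∞ (κ.pull fun w => (F w : ℂ)) κ.slit) {p : Coord n m}
    (hp : p ∈ κ.slit) (α : Fin m) :
    trConnC κ F α p = du α (hDet κ F) p / hDet κ F p := by
  rw [du_eq_act, act_hDet_div
    fun i j => differentiableAt_of_contDiffOn_slit (contDiffOn_hMat hF i j) hp]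
  simp only [trConnC, connC, ← du_eq_act, du_hMat_comm hF hp _ α]

/-- This form of the definition of N is free of the inverse matrix and can be differentiated without
differentiating h^{σ̄β}. -/
theorem sum_connN_mul_hMat {p : Coord n m} (h0 : hDet κ F p ≠ 0) (β σ : Fin m) :
    ∑ μ, connN A κ F β μ p * hMat κ F p μ σ
      = dRho A κ β (duBar σ (κ.pull fun w => (F w : ℂ))) p := by
  rw [← sum_mul_hInv_mul_hMat h0
    (fun σ => dRho A κ β (duBar σ (κ.pull fun w => (F w : ℂ))) p) σ]
  exact Finset.sum_congr rfl fun _ _ => mul_comm _ _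

/-- `∂̇_α N^α_β = δ_β(log h)`. -/
theorem sum_du_connN (hF : ContDiffOn ℝ ∞ (κ.pull fun w => (F w : ℂ)) κ.slit)
    (h0 : ∀ p ∈ κ.slit, hDet κ F p ≠ 0) {p : Coord n m} (hp : p ∈ κ.slit) (β : Fin m) :
    ∑ α, du α (connN A κ F β α) p = delta A κ F β (hDet κ F) p / hDet κ F p := by
  have hHd (i j : Fin m) := differentiableAt_of_contDiffOn_slit (contDiffOn_hMat hF i j) hp
  have hNd (α β : Fin m) :=
    differentiableAt_of_contDiffOn_slit (contDiffOn_connN (A := A) hF h0 α β) hp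
  have hRd (k : Fin n) (α : Fin m) :=
    differentiableAt_of_contDiffOn_slit (contDiffOn_rho_slit (A := A) (κ := κ) α k) hp
  have hS (σ : Fin m) := contDiffOn_wirtBar κ.isOpen_slit hF (0, Pi.single σ 1)
  have hSd (k : Fin n) (σ : Fin m) : DifferentiableAt ℝ
      (dz k (duBar σ (κ.pull fun w => (F w : ℂ)))) p :=
    differentiableAt_of_contDiffOn_slit (contDiffOn_wirt κ.isOpen_slit (hS σ) _) hp
  -- Apply ∂̇_α to N_β^μ h_{μσ̄} = ρ^k_β ∂_k ∂̇_σ̄ F. On the right ∂̇_α passes through, as ρ depends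
  -- on z alone; on the left N_β^μ ∂̇_α h_{μσ̄} = N_β^μ ∂̇_μ h_{ασ̄}, which moves to the right and
  -- completes δ_β.
  have key (α σ : Fin m) : ∑ μ, hMat κ F p μ σ * du α (connN A κ F β μ) p
      = delta A κ F β (fun q => hMat κ F q α σ) p := by
    have h1 : du α (dRho A κ β (duBar σ (κ.pull fun w => (F w : ℂ)))) p
        = dRho A κ β (fun q => hMat κ F q α σ) p := by
      have e : dRho A κ β (duBar σ (κ.pull fun w => (F w : ℂ)))
        = fun q => ∑ k, rho A κ β k q.1 * dz k (duBar σ (κ.pull fun w => (F w : ℂ))) q := rfl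
      rw [e, du_eq_act, act_sum fun k _ => (hRd k β).fun_mul (hSd k σ)]
      refine Finset.sum_congr rfl fun k _ => ?_
      rw [act_mul (hRd k β) (hSd k σ), ← du_eq_act, ← du_eq_act, du_rho hp, mul_zero,
        add_zero]
      congr 1
      exact wirt_comm (contDiffAt_infty.1
        ((hS σ).contDiffAt (κ.isOpen_slit.mem_nhds hp)) 2) _ _
    have h2 : dRho A κ β (duBar σ (κ.pull fun w => (F w : ℂ)))
        =ᶠ[nhds p] fun q => ∑ μ, connN A κ F β μ q * hMat κ F q μ σ := by
      filter_upwards [κ.isOpen_slit.mem_nhds hp] with q hq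
      exact (sum_connN_mul_hMat (h0 q hq) β σ).symm
    rw [du_eq_act, act_congr h2, act_sum fun μ _ => (hNd β μ).fun_mul (hHd μ σ)] at h1
    simp only [act_mul (hNd β _) (hHd _ σ), ← du_eq_act, Finset.sum_add_distrib] at h1
    rw [delta, ← h1, eq_sub_iff_add_eq, add_comm]
    simp only [du_hMat_comm hF hp α]
  -- Contracting `key` with h^{σ̄α} leaves the trace of ∂̇_α N_β^μ on one side and δ_β(log h) on the
  -- other.
  rw [delta_eq_act, act_hDet_div hHd]
  refine Finset.sum_congr rfl fun α _ => ?_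
  simp only [← delta_eq_act, ← key]
  exact (sum_hInv_mul_sum_hMat (h0 p hp) (fun μ => du α (connN A κ F β μ) p) α).symm

/-! ### The gradient -/

/-- The components along ∂_k are forced by the anchor, and the shift by N in δ𝒱^α undoes the one in
𝒳_α. -/
theorem mem_prolongationHol_iff {p : Coord n m} {g : EC m × TC n m} :
    g ∈ prolongationHol A κ p ↔ g = ∑ α, coZ α g • frameX A κ F α p
      + ∑ α, coV A κ F p α g • frameV α := by
  rw [sum_smul_frameX, sum_smul_frameV]
  constructor
  · rintro ⟨⟨h1, -⟩, h2, h3⟩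
    refine Prod.ext (Prod.ext ?_ ?_) (Prod.ext (Prod.ext ?_ ?_) ?_)
    · simp [coZ]
    · simp [h2]
    · funext k; simp [← h1 k, coZ, mul_comm]
    · funext α; simp [coZ, coV, mul_comm]
    · simp [h3]
  · intro h
    have h2 : g.1.2 = 0 := by rw [h]; simp
    have h3 : g.2.2 = 0 := by rw [h]; simp
    refine ⟨⟨fun k => ?_, fun k => by simp [h2, h3]⟩, h2, h3⟩
    have := congrFun (congrArg (fun x => x.2.1.1) h) k
    simpa [coZ, mul_comm] using this.symm

/-- Testing on the vectors (e_β̄, δ_β̄) and (0, ∂̇_β̄) decouples the equation into two linear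
systems with the same invertible matrix h_{αβ̄}, one for each block of components. -/
theorem isGradAt_iff {p : Coord n m} (h0 : hDet κ F p ≠ 0) (g : EC m × TC n m) :
    IsGradAt A κ F f p g ↔
      g = ∑ α, (∑ γ, hInv κ F γ α p * deltaBar A κ F γ (κ.pull f) p) • frameX A κ F α p
        + ∑ α, (∑ γ, hInv κ F γ α p * duBar γ (κ.pull f) p) • frameV α := by
  have hact {W} (hW : W ∈ prolongationAnti A κ p) : act W.2 (κ.pull f) p
      = ∑ β, deltaBar A κ F β (κ.pull f) p * coZBar β W
        + ∑ β, duBar β (κ.pull f) p * coVBar A κ F p β W := by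
    rw [act_eq_sum_coframe hW.1 (F := F)]
    simp [Fintype.sum_sum_type, frameDeriv, coframe, coZ, coV, hW.2.1, hW.2.2]
  have hmet (W) : metricG A κ F p g W = ∑ β, (∑ α, hMat κ F p α β * coZ α g) * coZBar β W
      + ∑ β, (∑ α, hMat κ F p α β * coV A κ F p α g) * coVBar A κ F p β W := by
    simp only [metricG, Finset.sum_mul]
    congr 1 <;> exact Finset.sum_comm
  constructor
  · rintro ⟨hg, h⟩
    rw [mem_prolongationHol_iff (F := F)] at hg
    have hX (β : Fin m) : frameXBar A κ F β p ∈ prolongationAnti A κ p :=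
      ⟨by simp [prolongation, frameXBar, Pi.single_apply], by simp [frameXBar], by simp [frameXBar]⟩
    have hV (β : Fin m) : (frameVBar β : EC m × TC n m) ∈ prolongationAnti A κ p :=
      ⟨by simp [prolongation, frameVBar], by simp [frameVBar], by simp [frameVBar]⟩
    have h1 (β : Fin m) : ∑ α, hMat κ F p α β * coZ α g = deltaBar A κ F β (κ.pull f) p := by
      have := h _ (hX β)
      rw [hmet, hact (hX β)] at this
      simpa [coZBar, coVBar, frameXBar, Pi.single_apply] using this
    have h2 (β : Fin m) : ∑ α, hMat κ F p α β * coV A κ F p α g = duBar β (κ.pull f) p := by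
      have := h _ (hV β)
      rw [hmet, hact (hV β)] at this
      simpa [coZBar, coVBar, frameVBar, Pi.single_apply] using this
    rw [hg]
    simp only [← h1, ← h2, sum_hInv_mul_sum_hMat h0 (fun α => coZ α g),
      sum_hInv_mul_sum_hMat h0 (fun α => coV A κ F p α g)]
  · intro hg
    have hZ (α : Fin m) : coZ α g = ∑ γ, hInv κ F γ α p * deltaBar A κ F γ (κ.pull f) p := by
      rw [hg, sum_smul_frameX, sum_smul_frameV]; simp [coZ]
    have hV (α : Fin m) : coV A κ F p α g = ∑ γ, hInv κ F γ α p * duBar γ (κ.pull f) p := by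
      rw [hg, sum_smul_frameX, sum_smul_frameV]; simp [coV, mul_comm (connN _ _ _ _ _ _)]
    refine ⟨?_, fun W hW => ?_⟩
    · rw [mem_prolongationHol_iff (F := F)]
      simp only [hZ, hV]
      exact hg
    · rw [hmet, hact hW]
      simp only [hZ, hV, sum_mul_hInv_mul_hMat h0 fun γ => deltaBar A κ F γ (κ.pull f) p,
        sum_mul_hInv_mul_hMat h0 fun γ => duBar γ (κ.pull f) p]

theorem grad_eq {p : Coord n m} (h0 : hDet κ F p ≠ 0) :
    grad A κ F f p
      = ∑ α, (∑ γ, hInv κ F γ α p * deltaBar A κ F γ (κ.pull f) p) • frameX A κ F α p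
        + ∑ α, (∑ γ, hInv κ F γ α p * duBar γ (κ.pull f) p) • frameV α := by
  have hex : ∃ g, IsGradAt A κ F f p g := ⟨_, (isGradAt_iff h0 _).2 rfl⟩
  rw [grad, dif_pos hex]
  exact (isGradAt_iff h0 _).1 hex.choose_spec

theorem horPart_of_eq {Z : Coord n m → EC m × TC n m} {p : Coord n m} {a b : Fin m → ℂ}
    (h : Z p = ∑ α, a α • frameX A κ F α p + ∑ α, b α • frameV α) :
    horPart A κ F Z p = ∑ α, a α • frameX A κ F α p := by
  have hZ (α : Fin m) : coZ α (Z p) = a α := by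
    rw [h, sum_smul_frameX, sum_smul_frameV]; simp [coZ]
  simp only [horPart, hZ]

theorem verPart_of_eq {Z : Coord n m → EC m × TC n m} {p : Coord n m} {a b : Fin m → ℂ}
    (h : Z p = ∑ α, a α • frameX A κ F α p + ∑ α, b α • frameV α) :
    verPart A κ F Z p = ∑ α, b α • frameV α := by
  have hV (α : Fin m) : coV A κ F p α (Z p) = b α := by
    rw [h, sum_smul_frameX, sum_smul_frameV]; simp [coV, mul_comm (connN _ _ _ _ _ _)]
  simp only [verPart, hV]

theorem gradH_eq {p : Coord n m} (h0 : hDet κ F p ≠ 0) :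
    gradH A κ F f p
      = ∑ α, (∑ γ, hInv κ F γ α p * deltaBar A κ F γ (κ.pull f) p) • frameX A κ F α p :=
  horPart_of_eq (grad_eq h0)

theorem gradV_eq {p : Coord n m} (h0 : hDet κ F p ≠ 0) :
    gradV A κ F f p = ∑ α, (∑ γ, hInv κ F γ α p * duBar γ (κ.pull f) p) • frameV α :=
  verPart_of_eq (grad_eq h0)

/-- `divH` projects its argument once more, so this idempotence is needed to identify the field
whose divergence is `lapH`. -/
theorem horPart_gradH {p : Coord n m} (h0 : hDet κ F p ≠ 0) :
    horPart A κ F (gradH A κ F f) p = gradH A κ F f p := by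
  rw [gradH_eq h0]
  exact horPart_of_eq (b := 0) (by rw [gradH_eq h0]; simp)

theorem verPart_gradV {p : Coord n m} (h0 : hDet κ F p ≠ 0) :
    verPart A κ F (gradV A κ F f) p = gradV A κ F f p := by
  rw [gradV_eq h0]
  exact verPart_of_eq (a := 0) (by rw [gradV_eq h0]; simp)

/-! ### The Laplacians -/

section

variable (hF : ContDiffOn ℝ ∞ (κ.pull fun w => (F w : ℂ)) κ.slit)
  (h0 : ∀ p ∈ κ.slit, hDet κ F p ≠ 0) (hf : ContDiffOn ℝ ∞ (κ.pull f) κ.slit)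

include hF h0 hf

/-- The term a^β ∂̇_α N^α_β = a^β δ_β(h)/h cancels one of the two copies coming from h²; the
remaining one joins δ_α a^α in (1/h) δ_α[h a^α]. -/
theorem isDivAt_gradH_iff {p : Coord n m} (hp : p ∈ κ.slit) (d : ℂ) :
    IsDivAt A κ F (gradH A κ F f) p d ↔
      d = 1 / hDet κ F p * ∑ α, delta A κ F α (fun q => hDet κ F q *
            ∑ γ, hInv κ F γ α q * deltaBar A κ F γ (κ.pull f) q) p
          - ∑ α, (∑ γ, hInv κ F γ α p * deltaBar A κ F γ (κ.pull f) p) * trC A κ α p := by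
  have hd := differentiableAt_of_contDiffOn_slit (contDiffOn_hDet hF) hp
  set a : Fin m → Coord n m → ℂ :=
    fun α q => ∑ γ, hInv κ F γ α q * deltaBar A κ F γ (κ.pull f) q
  have ha (α : Fin m) : DifferentiableAt ℝ (a α) p :=
    differentiableAt_of_contDiffOn_slit (ContDiffOn.sum fun γ _ =>
      (contDiffOn_hInv hF h0 γ α).mul (contDiffOn_deltaBar hF h0 hf γ)) hp
  have heq : gradH A κ F f =ᶠ[nhds p] fun q => ∑ α, a α q • frameX A κ F α q := by
    filter_upwards [κ.isOpen_slit.mem_nhds hp] with q hq using gradH_eq (h0 q hq)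
  rw [isDivAt_congr heq, isDivAt_sum_smul_frameX (contDiffOn_connN hF h0) hp hd (h0 p hp) ha]
  have hmul (α : Fin m) : delta A κ F α (fun q => hDet κ F q * a α q) p
      = hDet κ F p * delta A κ F α (a α) p + a α p * delta A κ F α (hDet κ F) p := by
    simp only [delta_eq_act, act_mul hd (ha α)]
  change _ ↔ d = 1 / hDet κ F p * ∑ α, delta A κ F α (fun q => hDet κ F q * a α q) p
    - ∑ α, a α p * trC A κ α p
  simp only [hmul, sum_du_connN hF h0 hp, Finset.sum_add_distrib, ← Finset.mul_sum, ← mul_div_assoc,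
    ← Finset.sum_div]
  have := h0 p hp
  refine Eq.congr_right ?_
  field_simp
  ring

/-- Nothing cancels here: of the two copies of b^α ∂̇_α(h)/h, one enters (1/h) ∂̇_α[h b^α] and the
other is b^α C_α. -/
theorem isDivAt_gradV_iff {p : Coord n m} (hp : p ∈ κ.slit) (d : ℂ) :
    IsDivAt A κ F (gradV A κ F f) p d ↔
      d = 1 / hDet κ F p * ∑ α, du α (fun q => hDet κ F q *
            ∑ γ, hInv κ F γ α q * duBar γ (κ.pull f) q) p
          + ∑ α, (∑ γ, hInv κ F γ α p * duBar γ (κ.pull f) p) * trConnC κ F α p := by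
  have hd := differentiableAt_of_contDiffOn_slit (contDiffOn_hDet hF) hp
  set b : Fin m → Coord n m → ℂ := fun α q => ∑ γ, hInv κ F γ α q * duBar γ (κ.pull f) q
  have hb (α : Fin m) : DifferentiableAt ℝ (b α) p :=
    differentiableAt_of_contDiffOn_slit (ContDiffOn.sum fun γ _ =>
      (contDiffOn_hInv hF h0 γ α).mul (contDiffOn_wirtBar κ.isOpen_slit hf _)) hp
  have heq : gradV A κ F f =ᶠ[nhds p] fun q => ∑ α, b α q • frameV α := by
    filter_upwards [κ.isOpen_slit.mem_nhds hp] with q hq using gradV_eq (h0 q hq)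
  rw [isDivAt_congr heq, isDivAt_sum_smul_frameV (contDiffOn_connN hF h0) hp hd (h0 p hp)]
  have hmul (α : Fin m) : du α (fun q => hDet κ F q * b α q) p
      = hDet κ F p * du α (b α) p + b α p * du α (hDet κ F) p := by
    simp only [du_eq_act, act_mul hd (hb α)]
  change _ ↔ d = 1 / hDet κ F p * ∑ α, du α (fun q => hDet κ F q * b α q) p
    + ∑ α, b α p * trConnC κ F α p
  simp only [hmul, trConnC_eq hF hp, Finset.sum_add_distrib, ← Finset.mul_sum,
    ← mul_div_assoc, ← Finset.sum_div]
  have := h0 p hp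
  refine Eq.congr_right ?_
  field_simp
  ring

end

end Laplacians

end FinslerAlgebroid

end

open FinslerAlgebroid Bundle in
open scoped Manifold ContDiff in
theorem mainTheorem3 {n m : ℕ} {M : Type*} [TopologicalSpace M] [ChartedSpace (Fin n → ℂ) M]
    [IsManifold 𝓘(ℂ, Fin n → ℂ) ω M]
    {E : M → Type*} [TopologicalSpace (TotalSpace (Fin m → ℂ) E)]
    [∀ x, AddCommGroup (E x)] [∀ x, Module ℂ (E x)] [∀ x, TopologicalSpace (E x)]
    [FiberBundle (Fin m → ℂ) E] [VectorBundle ℂ (Fin m → ℂ) E]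
    [ContMDiffVectorBundle ω (Fin m → ℂ) E 𝓘(ℂ, Fin n → ℂ)]
    (A : HolLieAlgebroid n m E)
    (F : TotalSpace (Fin m → ℂ) E → ℝ) (hF : IsFinslerFunction (n := n) F)
    (f : TotalSpace (Fin m → ℂ) E → ℂ) (hf : SmoothOffZero (n := n) f)
    (κ : HolCoords n m E) :
    (∀ p ∈ κ.slit,
      (∃! g, IsGradAt A κ F f p g) ∧
      gradH A κ F f p
        = ∑ α, (∑ γ, hInv κ F γ α p * deltaBar A κ F γ (κ.pull f) p) • frameX A κ F α p ∧
      gradV A κ F f p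
        = ∑ α, (∑ γ, hInv κ F γ α p * duBar γ (κ.pull f) p) • frameV α ∧
      (∃! d, IsDivAt A κ F (gradH A κ F f) p d) ∧
      (∃! d, IsDivAt A κ F (gradV A κ F f) p d)) ∧
    (∀ p ∈ κ.slit,
      lapH A κ F f p
        = 1 / hDet κ F p * ∑ α, delta A κ F α (fun q => hDet κ F q *
            ∑ γ, hInv κ F γ α q * deltaBar A κ F γ (κ.pull f) q) p
          - ∑ α, (∑ γ, hInv κ F γ α p * deltaBar A κ F γ (κ.pull f) p) * trC A κ α p) ∧
    (∀ p ∈ κ.slit,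
      lapV A κ F f p
        = 1 / hDet κ F p * ∑ α, du α (fun q => hDet κ F q *
            ∑ γ, hInv κ F γ α q * duBar γ (κ.pull f) q) p
          + ∑ α, (∑ γ, hInv κ F γ α p * duBar γ (κ.pull f) p) * trConnC κ F α p) := by
  have hF' : ContDiffOn ℝ ∞ (κ.pull fun w => (F w : ℂ)) κ.slit :=
    Complex.ofRealCLM.contDiff.comp_contDiffOn (hF.smooth.contDiffOn_comp_point κ)
  have hf' : ContDiffOn ℝ ∞ (κ.pull f) κ.slit := hf.contDiffOn_comp_point κ
  have h0 (p) (hp : p ∈ κ.slit) : hDet κ F p ≠ 0 :=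
    hF.hDet_ne_zero hp
  refine ⟨fun p hp => ⟨⟨_, (isGradAt_iff (h0 p hp) _).2 rfl,
      fun g hg => (isGradAt_iff (h0 p hp) g).1 hg⟩, gradH_eq (h0 p hp), gradV_eq (h0 p hp),
      ⟨_, (isDivAt_gradH_iff hF' h0 hf' hp _).2 rfl,
        fun d hd => (isDivAt_gradH_iff hF' h0 hf' hp d).1 hd⟩,
      ⟨_, (isDivAt_gradV_iff hF' h0 hf' hp _).2 rfl,
        fun d hd => (isDivAt_gradV_iff hF' h0 hf' hp d).1 hd⟩⟩,
    fun p hp => divergence_eq_of_isDivAt_iff fun d => ?_,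
    fun p hp => divergence_eq_of_isDivAt_iff fun d => ?_⟩
  · have h : horPart A κ F (gradH A κ F f) =ᶠ[nhds p] gradH A κ F f := by
      filter_upwards [κ.isOpen_slit.mem_nhds hp] with q hq using horPart_gradH (h0 q hq)
    rw [isDivAt_congr h, isDivAt_gradH_iff hF' h0 hf' hp]
  · have h : verPart A κ F (gradV A κ F f) =ᶠ[nhds p] gradV A κ F f := by
      filter_upwards [κ.isOpen_slit.mem_nhds hp] with q hq using verPart_gradV (h0 q hq)
    rw [isDivAt_congr h, isDivAt_gradV_iff hF' h0 hf' hp]
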